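/- Let $k$ be an algebraically closed field of characteristic $p$, and let $X=\mathbb{P}^1_k$ with coordinate $t$. A *deformation datum* on $X$ is a pair $(Z,\omega)$, where $Z\to X$ is a finite, at most tamely ramified Galois cover of smooth connected curves, with Galois group $H$, and $\omega\neq 0$ is a rational section of $\Omega_{Z/k}$ such that (i) there is an injective character $\chi:H\hookrightarrow\mathbb{F}_p^\times$ with $\sigma^*\omega=\chi(\sigma)\,\omega$ for all $\sigma\in H$, and (ii) $\omega$ is logarithmic, i.e. $\omega=\mathrm{d}v/v$ for some nonzero rational function $v$ on $Z$. For a closed point $x\in X$ choose a point $z\in Z$ above $x$, let $H_z\subset H$ be its stabilizer, and put $m_x=|H_z|$, $h_x=\mathrm{ord}_z\,\omega+1$, $\sigma_x=h_x/m_x$. The point $x$ is *supersingular* if $\sigma_x=(p+1)/(p-1)$, and *singular* if it is not supersingular and $\sigma_x\not\equiv 1\pmod p$. The *signature* of $(Z,\omega)$ is the map $x\mapsto\sigma_x$ on the set $M$ of all $x$ with $\sigma_x\neq 1,\frac{p+1}{p-1}$. Write $\sigma_x=\nu_x+a_x/(p-1)$ with $\nu_x\in\mathbb{Z}$ and $0\le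 a_x<p-1$. The datum is *special* if $\nu_x=0$ for exactly three points $x\in M$ and $\nu_x=1$ for all other $x\in M$. **Theorem.** For every prime $p\geq 11$ and every algebraically closed field $k$ of characteristic $p$ there exist $\lambda\in k\setminus\{0,1\}$ and a special deformation datum $(Z,\omega)$ on $\mathbb{P}^1_k$ whose singular points are exactly $1,\lambda,\infty,0$, whose signature is supported exactly on these four points, and for which $$(\sigma_1,\ \sigma_\lambda,\ \sigma_\infty,\ \sigma_0)=\Big(0,\ 0,\ \frac{p-8}{p-1},\ \frac{p+2}{p-1}\Big).$$ -/

import Mathlib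

/-!
Curves are handled through their function fields: over an algebraically closed field `k`, smooth
projective connected curves with finite separable covers are the same thing as function fields of
one variable over `k` with finite separable extensions.  The closed points of such a curve are the
places of its function field, and its rational differential forms are the Kaehler differentials of
its function field over `k`.
-/

open scoped KaehlerDifferential Pointwise

universe u

noncomputable section

/-- A place of a field `F` over `k`: a valuation subring of `F` containing `k`, different from `F`.
If `F` is the function field of a smooth projective curve over `k`, these are exactly the local
rings of the closed points of the curve. -/
@[ext]
structure CurvePlace (k F : Type u) [Field k] [Field F] [Algebra k F] where
  ring : ValuationSubring F
  algebraMap_mem : ∀ c : k, algebraMap k F c ∈ ring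
  ne_top : ring ≠ ⊤

namespace CurvePlace

section Order

variable {k F : Type u} [Field k] [Field F] [Algebra k F]

/-- The differential `ω` has order `n` at `z`, that is, `ω = g * s ^ n * ds` for a uniformizer `s`
and a unit `g` of the local ring at `z`. -/
def HasOrd (z : CurvePlace k F) (ω : Ω[F⁄k]) (n : ℤ) : Prop :=
  ∃ s g : z.ring, Irreducible s ∧ IsUnit g ∧
    ω = ((g : F) * (s : F) ^ n) • KaehlerDifferential.D k F (s : F)

/-- The order at `z` of a differential `ω ≠ 0`. -/
def ord (z : CurvePlace k F) (ω : Ω[F⁄k]) : ℤ :=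
  Classical.epsilon fun n : ℤ => z.HasOrd ω n

end Order

section Above

variable {k K L : Type u} [Field k] [Field K] [Field L] [Algebra k K] [Algebra k L] [Algebra K L]

/-- The place `z` of `L` lies above the place `x` of `K`. -/
def LiesAbove (z : CurvePlace k L) (x : CurvePlace k K) : Prop :=
  z.ring.comap (algebraMap K L) = x.ring

/-- The order `|H_z|` of the stabilizer of `z` in the Galois group `H` of `L / K`. -/
def stabilizerCard (K : Type u) [Field K] [Algebra K L] (z : CurvePlace k L) : ℕ :=
  Nat.card (z.ring.decompositionSubgroup K)

theorem exists_liesAbove [IsScalarTower k K L] (x : CurvePlace k K) :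
    ∃ z : CurvePlace k L, z.LiesAbove x := by
  obtain ⟨B, hB⟩ :=
    (x.ring.toLocalSubring.map (algebraMap K L)).exists_le_valuationSubring
  obtain ⟨h, hloc⟩ := hB
  have hmem : ∀ a ∈ x.ring, algebraMap K L a ∈ B := fun a ha => h ⟨a, ha, rfl⟩
  have key : B.comap (algebraMap K L) = x.ring := by
    refine le_antisymm (fun a ha => ?_) hmem
    by_contra hna
    have ha0 : a ≠ 0 := by rintro rfl; exact hna x.ring.zero_mem
    have hinv : a⁻¹ ∈ x.ring := (x.ring.mem_or_inv_mem a).resolve_left hna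
    let y : (x.ring.toLocalSubring.map (algebraMap K L)).toSubring :=
      ⟨algebraMap K L a⁻¹, a⁻¹, hinv, rfl⟩
    have hu : IsUnit (Subring.inclusion h y) := by
      refine isUnit_iff_exists_inv.mpr ⟨⟨algebraMap K L a, ha⟩, Subtype.ext ?_⟩
      change algebraMap K L a⁻¹ * algebraMap K L a = 1
      rw [← map_mul, inv_mul_cancel₀ ha0, map_one]
    obtain ⟨⟨w, b, hb, rfl⟩, hw⟩ := isUnit_iff_exists_inv.mp (hloc.map_nonunit y hu)
    have hw' : algebraMap K L a⁻¹ * algebraMap K L b = 1 := congrArg Subtype.val hw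
    rw [← map_mul] at hw'
    have hab : a⁻¹ * b = 1 := (algebraMap K L).injective (by rw [hw', map_one])
    have : b = a := by field_simp at hab; exact hab
    exact hna (this ▸ hb)
  refine ⟨⟨B, fun c => ?_, ?_⟩, key⟩
  · rw [IsScalarTower.algebraMap_apply k K L]
    exact hmem _ (x.algebraMap_mem c)
  · rintro rfl
    exact x.ne_top (top_le_iff.mp (key ▸ fun _ _ => trivial))

end Above

end CurvePlace

/-- The map `f^* : Ω[A⁄k] → Ω[B⁄k]`, `a da' ↦ f(a) d(f a')`, induced by a `k`-algebra map `f`. -/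
def differentialPullback {k A B : Type u} [Field k] [Field A] [Field B] [Algebra k A] [Algebra k B]
    (f : A →ₐ[k] B) : Ω[A⁄k] →+ Ω[B⁄k] :=
  letI : Algebra A B := f.toRingHom.toAlgebra
  haveI : IsScalarTower k A B := IsScalarTower.of_algebraMap_eq fun c => (f.commutes c).symm
  (KaehlerDifferential.map k k A B).toAddMonoidHom

theorem differentialPullback_smul_D {k A B : Type u} [Field k] [Field A] [Field B] [Algebra k A]
    [Algebra k B] (f : A →ₐ[k] B) (a b : A) :
    differentialPullback f (a • KaehlerDifferential.D k A b) =
      f a • KaehlerDifferential.D k B (f b) := by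
  letI : Algebra A B := f.toRingHom.toAlgebra
  haveI : IsScalarTower k A B := IsScalarTower.of_algebraMap_eq fun c => (f.commutes c).symm
  change KaehlerDifferential.map k k A B (a • KaehlerDifferential.D k A b) = _
  rw [map_smul, KaehlerDifferential.map_D, algebra_compatible_smul B a]
  rfl

/-- A deformation datum `(Z, ω)` on the smooth projective curve `X` with function field `K` over
the algebraically closed field `k` of characteristic `p`.  The cover `Z → X` is given by the
extension `L / K` of function fields, and the covering group `H` is `L ≃ₐ[K] L`. -/
structure DeformationDatum (p : ℕ) (k K : Type u) [Field k] [Field K] [Algebra k K] where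
  L : Type u
  [fieldL : Field L]
  [algebraL : Algebra K L]
  [algebraConst : Algebra k L]
  [scalarTower : IsScalarTower k K L]
  [finite : FiniteDimensional K L]
  [galois : IsGalois K L]
  tame : ∀ z : CurvePlace k L, p.Coprime (z.stabilizerCard K)
  ω : Ω[L⁄k]
  ω_ne_zero : ω ≠ 0
  χ : (L ≃ₐ[K] L) →* (ZMod p)ˣ
  χ_injective : Function.Injective χ
  pullback_ω : ∀ τ : L ≃ₐ[K] L,
    differentialPullback ((τ : L →ₐ[K] L).restrictScalars k) ω =
      ((χ τ : ZMod p).cast : k) • ω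
  logarithmic : ∃ v : L, v ≠ 0 ∧ ω = v⁻¹ • KaehlerDifferential.D k L v

namespace DeformationDatum

attribute [instance] fieldL algebraL algebraConst scalarTower finite galois

variable {p : ℕ} {k K : Type u} [Field k] [Field K] [Algebra k K] (d : DeformationDatum p k K)

/-- A point `z` of `Z` above the point `x` of `X`. -/
def above (x : CurvePlace k K) : CurvePlace k d.L :=
  (CurvePlace.exists_liesAbove (L := d.L) x).choose

/-- `m_x = |H_z|`. -/
def m (x : CurvePlace k K) : ℕ := (d.above x).stabilizerCard K

/-- `h_x = ord_z ω + 1`. -/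
def h (x : CurvePlace k K) : ℤ := (d.above x).ord d.ω + 1

/-- `σ_x = h_x / m_x`. -/
def sigma (x : CurvePlace k K) : ℚ := (d.h x : ℚ) / (d.m x : ℚ)

/-- `x` is a supersingular point. -/
def IsSupersingular (x : CurvePlace k K) : Prop :=
  d.sigma x = ((p : ℚ) + 1) / ((p : ℚ) - 1)

/-- `x` is a singular point: it is not supersingular, and `σ_x` is not congruent to `1` modulo `p`
(in the ring of rational numbers with denominator prime to `p`). -/
def IsSingular (x : CurvePlace k K) : Prop :=
  ¬ d.IsSupersingular x ∧ ¬ ((p : ℤ) ∣ (d.sigma x - 1).num)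

/-- The set of points on which the signature of `(Z, ω)` is defined. -/
def signatureSet : Set (CurvePlace k K) :=
  {x | d.sigma x ≠ 1 ∧ ¬ d.IsSupersingular x}

/-- Write `σ_x = ν_x + a_x / (p - 1)` with `0 ≤ a_x < p - 1`, so that `ν_x = ⌊σ_x⌋`.  The datum is
special if `ν_x = 0` for exactly three points of the signature and `ν_x = 1` for the others. -/
def IsSpecial : Prop :=
  {x ∈ d.signatureSet | ⌊d.sigma x⌋ = 0}.ncard = 3 ∧
    ∀ x ∈ d.signatureSet, ⌊d.sigma x⌋ ≠ 0 → ⌊d.sigma x⌋ = 1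

end DeformationDatum

namespace ProjectiveLine

variable {k : Type u} [Field k]

/-- The prime ideal `(t - a)` of `k[t]`. -/
def pointIdeal (a : k) : IsDedekindDomain.HeightOneSpectrum (Polynomial k) where
  asIdeal := Ideal.span {Polynomial.X - Polynomial.C a}
  isPrime := (Ideal.span_singleton_prime (Polynomial.X_sub_C_ne_zero a)).mpr
    (Polynomial.prime_X_sub_C a)
  ne_bot := by
    rw [ne_eq, Ideal.span_singleton_eq_bot]
    exact Polynomial.X_sub_C_ne_zero a

/-- The point `t = a` of the projective line over `k`, with function field `k(t)`. -/
def finitePlace (a : k) : CurvePlace k (RatFunc k) where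
  ring := ((pointIdeal a).valuation (RatFunc k)).valuationSubring
  algebraMap_mem c := by
    rw [Valuation.mem_valuationSubring_iff, IsScalarTower.algebraMap_apply k (Polynomial k)]
    exact (pointIdeal a).valuation_le_one _
  ne_top h := by
    have h1 : (algebraMap (Polynomial k) (RatFunc k) (Polynomial.X - Polynomial.C a))⁻¹ ∈
        ((pointIdeal a).valuation (RatFunc k)).valuationSubring := h ▸ trivial
    have h2 : (pointIdeal a).valuation (RatFunc k)
        (algebraMap (Polynomial k) (RatFunc k) (Polynomial.X - Polynomial.C a)) < 1 :=
      ((pointIdeal a).valuation_lt_one_iff_mem _).mpr (Ideal.mem_span_singleton_self _)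
    rw [Valuation.mem_valuationSubring_iff, map_inv₀] at h1
    have h3 : (pointIdeal a).valuation (RatFunc k)
        (algebraMap (Polynomial k) (RatFunc k) (Polynomial.X - Polynomial.C a)) ≠ 0 := by
      rw [ne_eq, Valuation.zero_iff]
      exact RatFunc.algebraMap_ne_zero (Polynomial.X_sub_C_ne_zero a)
    exact absurd h1 (not_le.mpr ((one_lt_inv₀ (zero_lt_iff.mpr h3)).mpr h2))

open Classical in
/-- The point `t = ∞` of the projective line over `k`. -/
def inftyPlace (k : Type u) [Field k] : CurvePlace k (RatFunc k) where
  ring := (RatFunc.inftyValuation k).valuationSubring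
  algebraMap_mem c := by
    rw [Valuation.mem_valuationSubring_iff]
    by_cases hc : c = 0
    · simp [hc]
    · exact (RatFunc.inftyValuation.C k hc).le
  ne_top h := by
    have h1 : (RatFunc.X : RatFunc k) ∈ (RatFunc.inftyValuation k).valuationSubring := h ▸ trivial
    rw [Valuation.mem_valuationSubring_iff, RatFunc.inftyValuation.X, ← WithZero.exp_zero,
      WithZero.exp_le_exp] at h1
    omega

end ProjectiveLine

end

/-! The cover is `z ^ (p - 1) = c t³ (t - b₁)² (t - b₂)²` and the form is `ω = z dt / ((t - 1) (t -
λ))`. Where the right-hand side of the Kummer equation has order `n`, and `ω` is `z dπ` times a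
function of order `l` in the local coordinate `π`, tame ramification gives `σ = l + 1 + n / (p -
1)`. This yields the four prescribed values at `1, λ, ∞, 0`, the supersingular value at `b₁` and
`b₂`, and `1` everywhere else. What remains is to choose `λ, b₁, b₂, c` so that `ω` is logarithmic.

Let `D = d/dt` and `ω = u dt`. If `D^(p-1) u = -u^p`, Jacobson's formula gives `(D - u)^p = D^p`.
This operator kills `1`, so the last nonzero `(D - u)^n 1` is a solution `v` of `D v = u v`, that is
`ω = dv / v` (`Derivation.exists_logarithmic`).

Now `z^p` is a constant for `D`, and `u` is `z^p / c` times `1 / ((t - 1) (t - λ) t³ (t - b₁)² (t -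
b₂)²)`. If that rational function has no residue at `0, b₁, b₂`, it equals `ρ / ((t - 1) (t - λ)) +
D W` with `W` rational. Since `D^p` vanishes on `k(t)` and `D^(p-1)` sends `1 / (t - a)` to `-1 / (t
- a)^p`, the equation for `u` holds with `c = ρ (λ - 1)^(p-1)`
(`Derivation.iterate_pred_char_eq_neg_pow`). The vanishing of the three residues is solved
explicitly over a root of the cubic `35 y³ + 48 y² + 21 y + 3`, as soon as `2, 3, 5, 7` are
invertible (`exists_residue_free_quadratics`).

The formula for `σ` rests on a local description of Kummer extensions, `TameChart`: it shows that
the valuation ring is discrete, computes `dπ` in terms of a uniformizer, and identifies the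
stabilizer. -/

/-! ### The residue-free configuration. -/

open Polynomial in
/-- The differential `dX / ((X-α)(X-β) X³ (X-b₁)² (X-b₂)²)` has zero residues at `0`, `b₁`, `b₂` for
suitable pairwise distinct points: it equals `ρ dX / ((X-α)(X-β)) + d (V / (X² (X-b₁) (X-b₂)))`. -/
theorem exists_residue_free_quadratics {k : Type u} [Field k] [IsAlgClosed k] (h2 : (2 : k) ≠ 0)
    (h3 : (3 : k) ≠ 0) (h5 : (5 : k) ≠ 0) (h7 : (7 : k) ≠ 0) :
    ∃ (α β b₁ b₂ ρ : k) (V : k[X]), α ≠ β ∧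
      C ρ * X ^ 3 * ((X - C b₁) * (X - C b₂)) ^ 2 + (X - C α) * (X - C β) *
        (X * ((X - C b₁) * (X - C b₂)) * derivative V -
          V * (2 * ((X - C b₁) * (X - C b₂)) + X * (2 * X - C (b₁ + b₂)))) = 1 := by
  -- All constraints collapse to this cubic: after clearing the denominator `201684`, every
  -- coefficient of the final polynomial identity is a multiple of it.
  obtain ⟨y, hy⟩ : ∃ y : k, 35 * y ^ 3 + 48 * y ^ 2 + 21 * y + 3 = 0 := by
    have h35 : (35 : k) ≠ 0 := by
      have : (35 : k) = 5 * 7 := by norm_num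
      rw [this]; exact mul_ne_zero h5 h7
    obtain ⟨y, hy⟩ := IsAlgClosed.exists_root
      (C 35 * X ^ 3 + C 48 * X ^ 2 + C 21 * X + C 3 : k[X]) (by rw [degree_cubic h35]; decide)
    exact ⟨y, by simpa [IsRoot.def] using hy⟩
  have quad : ∀ b c : k, ∃ r, r ^ 2 + b * r + c = 0 := fun b c => by
    obtain ⟨r, hr⟩ := IsAlgClosed.exists_root
      (C 1 * X ^ 2 + C b * X + C c : k[X]) (by rw [degree_quadratic one_ne_zero]; decide)
    exact ⟨r, by simpa [IsRoot.def] using hr⟩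
  -- The scale of `t` is fixed by `b₁ + b₂ = -4`; then `α + β = 7 y`, and both quadratics have
  -- coefficients that are polynomials in `y`.
  obtain ⟨α, hα⟩ := quad (-7 * y) (49 * (3 * y + 1) ^ 2)
  obtain ⟨b, hb⟩ := quad 4 (42 * (1 + 5 * y + 7 * y ^ 2))
  have hM : (201684 : k) ≠ 0 := by
    have : (201684 : k) = 2 ^ 2 * 3 * 7 ^ 5 := by norm_num
    rw [this]
    exact mul_ne_zero (mul_ne_zero (pow_ne_zero _ h2) h3) (pow_ne_zero _ h7)
  -- The common denominator is `2² · 3 · 7⁵`. Comparing coefficients of `X ^ 7` forces the leading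
  -- coefficient of the cubic `V` to be `ρ`.
  refine ⟨α, 7 * y - α, b, -4 - b, (201684 : k)⁻¹ * (158916 + 994872 * y + 1147440 * y ^ 2),
    C (201684 : k)⁻¹ * (C (-223489 - 1022287 * y - 1039290 * y ^ 2)
      + C (-210868 - 533680 * y - 323400 * y ^ 2) * X
      + C (291432 + 2126070 * y + 2564100 * y ^ 2) * X ^ 2
      + C (158916 + 994872 * y + 1147440 * y ^ 2) * X ^ 3), ?_, ?_⟩
  · intro h
    -- The discriminant of the first quadratic is `-49 (5 y + 2) (7 y + 2)`. At `y = -2/5` the cubic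
    -- times `25` equals `1`, and at `y = -2/7` the cubic times `49` equals `5`, so neither factor
    -- vanishes.
    have h1 : 49 * ((5 * y + 2) * (7 * y + 2)) = 0 := by
      linear_combination (-1 : k) * (2 * α - 7 * y) * h + 4 * hα
    have h49 : (49 : k) ≠ 0 := by
      have : (49 : k) = 7 ^ 2 := by norm_num
      rw [this]; exact pow_ne_zero _ h7
    rcases mul_eq_zero.mp ((mul_eq_zero.mp h1).resolve_left h49) with h | h
    · refine one_ne_zero (α := k) ?_
      linear_combination 25 * hy - (35 * 5 * y ^ 2 + 170 * y + 37) * h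
    · refine h5 ?_
      linear_combination 49 * hy - (35 * 7 * y ^ 2 + 266 * y + 71) * h
  · have hP : (X - C α) * (X - C (7 * y - α)) =
        X ^ 2 - 7 * C y * X + 49 * (3 * C y + 1) ^ 2 := by
      have := congrArg (C : k → k[X]) hα
      simp only [C_add, C_mul, C_pow, C_neg, C_ofNat, C_0, C_1] at this
      simp only [C_sub, C_mul, C_ofNat]
      linear_combination -this
    have hQ : (X - C b) * (X - C (-4 - b)) =
        X ^ 2 + 4 * X + 42 * (1 + 5 * C y + 7 * C y ^ 2) := by
      have := congrArg (C : k → k[X]) hb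
      simp only [C_add, C_mul, C_pow, C_ofNat, C_0, C_1] at this
      simp only [C_sub, C_neg, C_ofNat]
      linear_combination -this
    have hc := congrArg (C : k → k[X]) hy
    have hMi : (C (201684 : k)⁻¹ : k[X]) * 201684 = 1 := by
      rw [← C_ofNat, ← C_mul, inv_mul_cancel₀ hM, C_1]
    rw [hP, hQ]
    simp only [C_add, C_mul, C_pow, C_neg, C_sub, C_ofNat, C_0, derivative_add, derivative_mul,
      derivative_C, derivative_X, derivative_pow, derivative_ofNat, derivative_sub,
      derivative_neg, zero_mul, mul_zero, zero_add, add_zero, sub_zero, Nat.cast_ofNat] at hc ⊢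
    generalize (C (201684 : k)⁻¹ : k[X]) = m at hMi ⊢
    generalize (C y : k[X]) = Y at hc ⊢
    linear_combination m * ((306559680 + 2629555992 * Y + 7647252228 * Y ^ 2 + 7699891752 * Y ^ 3)
      + (188459292 + 1057486836 * Y + 1866153240 * Y ^ 2 + 1198002960 * Y ^ 3) * X
      + (48412392 + 83554800 * Y - 19015920 * Y ^ 2) * X ^ 2
      + (197597400 + 1873191600 * Y + 6344748144 * Y ^ 2 + 7084294560 * Y ^ 3) * X ^ 3
      + (9138780 - 1668744 * Y - 67469472 * Y ^ 2) * X ^ 4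
      + (4748688 + 14457744 * Y) * X ^ 5 + 229488 * X ^ 6) * hc + hMi

open Polynomial in
/-- The configuration of `exists_residue_free_quadratics`, normalized by `α = 1`. -/
theorem exists_residue_free_configuration {k : Type u} [Field k] [IsAlgClosed k] (h2 : (2 : k) ≠ 0)
    (h3 : (3 : k) ≠ 0) (h5 : (5 : k) ≠ 0) (h7 : (7 : k) ≠ 0) :
    ∃ (l b₁ b₂ ρ : k) (V : k[X]), l ≠ 1 ∧
      C ρ * X ^ 3 * ((X - C b₁) * (X - C b₂)) ^ 2 + (X - C 1) * (X - C l) *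
        (X * ((X - C b₁) * (X - C b₂)) * derivative V -
          V * (2 * ((X - C b₁) * (X - C b₂)) + X * (2 * X - C (b₁ + b₂)))) = 1 := by
  obtain ⟨α, β, b₁, b₂, ρ, V, hne, h⟩ := exists_residue_free_quadratics h2 h3 h5 h7
  -- At `X = 0` the identity reads `-2 α β b₁ b₂ V(0) = 1`.
  have hα : α ≠ 0 := by
    rintro rfl
    simpa using congrArg (eval 0) h
  -- Substitute `α X` for `X`; the powers `7` and `4` of `α` compensate the degrees of the two
  -- summands.
  refine ⟨β / α, b₁ / α, b₂ / α, α ^ 7 * ρ, C (α ^ 4) * V.comp (C α * X), ?_, ?_⟩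
  · rw [ne_eq, div_eq_one_iff_eq hα]
    exact hne.symm
  · have h' := congrArg (fun q : k[X] => q.comp (C α * X)) h
    simp only [add_comp, mul_comp, pow_comp, sub_comp, X_comp, C_comp, ofNat_comp, one_comp,
      Nat.cast_ofNat] at h'
    have key : ∀ c : k, (C c : k[X]) = C α * C (c / α) := fun c => by
      rw [← C_mul, mul_div_cancel₀ _ hα]
    rw [key b₁, key b₂, key β, C_add, key b₁, key b₂] at h'
    have hd : derivative (C (α ^ 4) * V.comp (C α * X)) =
        C (α ^ 5) * (derivative V).comp (C α * X) := by
      rw [derivative_C_mul, derivative_comp, derivative_C_mul, derivative_X, C_pow, C_pow]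
      ring
    rw [hd, C_1, C_add]
    simp only [C_mul, C_pow]
    linear_combination h'

/-! ### Jacobson's formula and logarithmic derivatives. -/

section Jacobson

variable {R : Type*} [Ring R] {p : ℕ}

theorem natCast_choose_pred_of_cast_eq_zero (hp : p.Prime) (h0 : (p : R) = 0) {j : ℕ} (hj : j < p) :
    ((p - 1).choose j : R) = (-1) ^ j := by
  induction j with
  | zero => simp
  | succ j ih =>
    have h1 : (p.choose (j + 1) : R) = 0 := by
      obtain ⟨c, hc⟩ := hp.dvd_choose_self j.succ_ne_zero hj
      rw [hc, Nat.cast_mul, h0, zero_mul]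
    obtain ⟨q, rfl⟩ : ∃ q, p = q + 1 := ⟨p - 1, (Nat.succ_pred_prime hp).symm⟩
    rw [Nat.choose_succ_succ, Nat.cast_add] at h1
    rw [Nat.add_sub_cancel] at ih ⊢
    rw [ih (by omega)] at h1
    rw [pow_succ, mul_neg_one]
    exact (neg_eq_of_add_eq_zero_right h1).symm

/-- The binomial coefficients of `p - 1` are alternating signs, which cancel the signs of the powers
of `-y`. The lemma is applied to left and right multiplication by `a`, whose difference is the
commutator with `a`. -/
theorem sub_pow_pred_of_cast_eq_zero (hp : p.Prime) (h0 : (p : R) = 0) {x y : R}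
    (h : Commute x y) : (x - y) ^ (p - 1) = ∑ i ∈ Finset.range p, x ^ i * y ^ (p - 1 - i) := by
  have hp1 : p - 1 + 1 = p := Nat.sub_add_cancel hp.one_le
  rw [sub_eq_add_neg, h.neg_right.add_pow, hp1]
  refine Finset.sum_congr rfl fun i hi => ?_
  have hi' := Finset.mem_range.mp hi
  rw [← Nat.choose_symm (by omega), natCast_choose_pred_of_cast_eq_zero hp h0 (by omega),
    neg_pow y, mul_assoc, ((Commute.neg_one_right _).pow_right _).eq, ← mul_assoc ((-1 : R) ^ _),
    ← pow_add, Even.neg_one_pow ⟨_, rfl⟩, one_mul]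

/-- If `c 0 = b`, `c 1 = [a, b]`, `c 2 = [a, [a, b]]`, …, then
`∑ aⁱ b a ^ (p - 1 - i) = c (p - 1)` in characteristic `p`. -/
theorem sum_pow_mul_mul_pow_of_cast_eq_zero (hp : p.Prime) (h0 : (p : R) = 0) {a : R} {c : ℕ → R}
    (hc : ∀ i, a * c i - c i * a = c (i + 1)) :
    ∑ i ∈ Finset.range p, a ^ i * c 0 * a ^ (p - 1 - i) = c (p - 1) := by
  have h1 : ∀ n, ((LinearMap.mulLeft ℤ a - LinearMap.mulRight ℤ a) ^ n) (c 0) = c n := by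
    intro n
    induction n with
    | zero => simp
    | succ n ih => rw [pow_succ', Module.End.mul_apply, ih, ← hc n]; rfl
  have h2 : ((p : ℕ) : Module.End ℤ R) = 0 := by
    ext x
    rw [Module.End.natCast_apply, nsmul_eq_mul, h0, zero_mul, LinearMap.zero_apply]
  rw [← h1 (p - 1), sub_pow_pred_of_cast_eq_zero hp h2 (LinearMap.commute_mulLeft_right a a),
    LinearMap.sum_apply]
  refine Finset.sum_congr rfl fun i _ => ?_
  rw [LinearMap.pow_mulLeft, LinearMap.pow_mulRight, Module.End.mul_apply,
    LinearMap.mulLeft_apply, LinearMap.mulRight_apply, mul_assoc]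

open Polynomial in
theorem derivative_pow_eq_sum (t : R[X]) (n : ℕ) : derivative (t ^ n) =
    ∑ i ∈ Finset.range n, t ^ i * derivative t * t ^ (n - 1 - i) := by
  induction n with
  | zero => simp
  | succ n ih =>
    rw [pow_succ, derivative_mul, ih, Finset.sum_range_succ, Finset.sum_mul]
    congr 1
    · refine Finset.sum_congr rfl fun i hi => ?_
      have := Finset.mem_range.mp hi
      rw [mul_assoc, ← pow_succ]
      congr 2
      omega
    · simp

open Polynomial in
/-- Jacobson's formula for `(a + b) ^ p` in the case where `b` commutes with all iterated
commutators `c i = [a, [a, …, [a, b]…]]`. -/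
theorem add_pow_char_of_commutators (hp : p.Prime) (h0 : (p : R) = 0) {a b : R} {c : ℕ → R}
    (hc0 : c 0 = b) (hc : ∀ i, a * c i - c i * a = c (i + 1)) (hb : ∀ i, Commute b (c i)) :
    (a + b) ^ p = a ^ p + c (p - 1) + b ^ p := by
  set t : R[X] := C a + C b * X with ht
  -- As `b` commutes with every `c i`, commutators with `t = a + b X` agree with commutators with
  -- `a` on them, so the derivative is constant in `X`.
  have hd : derivative (t ^ p) = C (c (p - 1)) := by
    rw [derivative_pow_eq_sum,
      ← sum_pow_mul_mul_pow_of_cast_eq_zero (a := t) (c := fun i => C (c i)) hp ?_ ?_]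
    · simp [ht, hc0]
    · rw [← C_eq_natCast, h0, C_0]
    · intro i
      rw [ht, add_mul, mul_add, mul_assoc, X_mul_C, ← mul_assoc, ← mul_assoc, ← C_mul, ← C_mul,
        ← C_mul, ← C_mul, (hb i).eq, add_sub_add_right_eq_sub, ← C_sub, hc]
  have hdeg : t.natDegree ≤ 1 := by
    rw [ht, add_comm]
    exact natDegree_linear_le
  have hdp : (t ^ p).natDegree < p + 1 := by
    have := natDegree_pow_le_of_le p hdeg
    omega
  -- The derivative being constant, `i + 1` times this coefficient is zero, and `i + 1` is
  -- invertible in `R` because it is prime to `p`.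
  have hmid : ∀ i, i ≠ 0 → i + 1 < p → (t ^ p).coeff (i + 1) = 0 := by
    intro i hi hip
    have h1 := congrArg (fun f => coeff f i) hd
    simp only [coeff_derivative, coeff_C, if_neg hi] at h1
    obtain ⟨u, v, huv⟩ : IsCoprime ((i + 1 : ℕ) : ℤ) (p : ℤ) :=
      Nat.isCoprime_iff_coprime.mpr (Nat.coprime_of_lt_prime i.succ_ne_zero hip hp).symm
    have h2 := congrArg (Int.cast : ℤ → R) huv
    push_cast at h2
    rw [h0, mul_zero, add_zero] at h2
    rw [← mul_one ((t ^ p).coeff (i + 1)), ← h2, (Int.cast_commute u _).eq, ← mul_assoc, h1,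
      zero_mul]
  have hcoeff0 : (t ^ p).coeff 0 = a ^ p := by
    rw [← constantCoeff_apply, map_pow]
    simp [ht]
  have hcoeff1 : (t ^ p).coeff 1 = c (p - 1) := by
    have h1 := congrArg (fun f => coeff f 0) hd
    simpa [coeff_derivative] using h1
  have hcoeffp : (t ^ p).coeff p = b ^ p := by
    have := coeff_pow_of_natDegree_le (m := p) hdeg
    rw [mul_one] at this
    rw [this]
    simp [ht]
  -- Evaluation at `X = 1` is a ring homomorphism although `R` is not commutative, because `1` is
  -- central.
  let e : R[X] →+* R := eval₂RingHom' (RingHom.id R) 1 fun r => Commute.one_right r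
  have he : e t = a + b := by simp [e, ht]
  have hsum : e (t ^ p) = ∑ i ∈ Finset.range (p + 1), (t ^ p).coeff i := by
    change eval₂ (RingHom.id R) 1 (t ^ p) = _
    rw [eval₂_eq_sum_range' _ hdp]
    simp
  obtain ⟨q, hq⟩ : ∃ q, p = q + 2 := ⟨p - 2, by have := hp.two_le; omega⟩
  rw [← he, ← map_pow, hsum, Finset.sum_range_succ, hcoeffp, hq, Finset.sum_range_succ', ← hq,
    hcoeff0, Finset.sum_range_succ', hcoeff1, Finset.sum_eq_zero fun i hi => ?_]
  · abel
  · have := Finset.mem_range.mp hi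
    exact hmid (i + 1) i.succ_ne_zero (by omega)

end Jacobson

/-- In characteristic `p`, if `D ^ (p - 1) u = - u ^ p`, then `u` is a logarithmic derivative. -/
theorem Derivation.exists_logarithmic {k L : Type*} [Field k] [Field L] [Algebra k L] {p : ℕ}
    (hp : p.Prime) [CharP L p] (D : Derivation k L L) {u : L} (hu : D^[p - 1] u = -u ^ p) :
    ∃ v, v ≠ 0 ∧ D v = u * v := by
  let a : Module.End k L := D
  let m : L → Module.End k L := fun x => LinearMap.mulLeft k x
  have h0 : ((p : ℕ) : Module.End k L) = 0 := by
    ext x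
    rw [Module.End.natCast_apply, nsmul_eq_mul, CharP.cast_eq_zero, zero_mul, LinearMap.zero_apply]
  -- The commutator of `D` with multiplication by `x` is multiplication by `D x`. Hence all iterated
  -- commutators are multiplications, and they commute with `b`.
  have key := add_pow_char_of_commutators hp h0 (a := a) (b := m (-u))
    (c := fun i => m (-(D^[i] u))) rfl ?_ ?_
  · have h1 : (a ^ p) 1 = 0 := by
      rw [← Nat.sub_add_cancel hp.one_le, pow_succ, Module.End.mul_apply]
      change (a ^ (p - 1)) (D 1) = 0
      rw [D.map_one_eq_zero, map_zero]
    -- The multiplication part is `u ^ p + (-u) ^ p`: it cancels for odd `p` and is `2 u ^ 2 = 0`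
    -- for `p = 2`.
    have h2 : ((a + m (-u)) ^ p) 1 = 0 := by
      rw [key, LinearMap.add_apply, LinearMap.add_apply, h1, LinearMap.pow_mulLeft]
      simp only [m, LinearMap.mulLeft_apply, hu]
      rcases hp.eq_two_or_odd' with rfl | hodd
      · have := CharTwo.two_eq_zero (R := L)
        linear_combination u ^ 2 * this
      · rw [hodd.neg_pow]
        ring
    have h3 : ∃ n, ((a + m (-u)) ^ n) 1 = 0 := ⟨p, h2⟩
    classical
    have hn0 : Nat.find h3 ≠ 0 := fun h => by
      have := Nat.find_spec h3
      rw [h, pow_zero, Module.End.one_apply] at this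
      exact one_ne_zero this
    obtain ⟨n, hn⟩ := Nat.exists_eq_succ_of_ne_zero hn0
    -- With `n + 1` the least exponent killing `1`, the vector `(D - u)^n 1` is nonzero and lies in
    -- the kernel of `D - u`.
    refine ⟨((a + m (-u)) ^ n) 1, Nat.find_min h3 (by omega), ?_⟩
    have := Nat.find_spec h3
    rw [hn, Nat.succ_eq_add_one, pow_succ', Module.End.mul_apply, LinearMap.add_apply] at this
    change D _ + -u * _ = 0 at this
    linear_combination this
  · intro i
    ext x
    change D (-(D^[i] u) * x) - -(D^[i] u) * D x = -(D^[i + 1] u) * x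
    rw [D.leibniz, Function.iterate_succ_apply', map_neg]
    simp only [smul_eq_mul]
    ring
  · intro i
    ext x
    change -u * (-(D^[i] u) * x) = -(D^[i] u) * (-u * x)
    ring

/-! ### Values of polynomials at a place. -/

namespace CurvePlace

section

variable {k L : Type u} [Field k] [Field L] [Algebra k L] (B : CurvePlace k L)

theorem valuation_algebraMap {c : k} (hc : c ≠ 0) : B.ring.valuation (algebraMap k L c) = 1 := by
  refine le_antisymm ((B.ring.valuation_le_one_iff _).mpr (B.algebraMap_mem c)) ?_
  have h := (B.ring.valuation_le_one_iff _).mpr (B.algebraMap_mem c⁻¹)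
  rw [map_inv₀, map_inv₀] at h
  have h0 : B.ring.valuation (algebraMap k L c) ≠ 0 := by simpa using hc
  exact (inv_le_one₀ (zero_lt_iff.mpr h0)).mp h

theorem valuation_algebraMap_le (c : k) : B.ring.valuation (algebraMap k L c) ≤ 1 :=
  (B.ring.valuation_le_one_iff _).mpr (B.algebraMap_mem c)

theorem eq_zero_of_valuation_algebraMap_lt_one {c : k}
    (h : B.ring.valuation (algebraMap k L c) < 1) : c = 0 := by
  by_contra hc
  exact h.ne (B.valuation_algebraMap hc)

open Polynomial in
theorem valuation_aeval_le {x : L} (hx : B.ring.valuation x ≤ 1) (q : k[X]) :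
    B.ring.valuation (aeval x q) ≤ 1 := by
  rw [B.ring.valuation_le_one_iff] at hx ⊢
  induction q using Polynomial.induction_on' with
  | add p q hp hq => rw [map_add]; exact B.ring.add_mem _ _ hp hq
  | monomial n a =>
    rw [aeval_monomial]
    exact B.ring.mul_mem _ _ (B.algebraMap_mem a) (B.ring.pow_mem hx n)

-- `X - c` divides `q - q(c)`. Thus residues of polynomial expressions are computed by evaluation,
-- with no appeal to a residue field.
open Polynomial in
theorem valuation_aeval_sub_lt {x : L} {c : k} (hx : B.ring.valuation (x - algebraMap k L c) < 1)
    (q : k[X]) : B.ring.valuation (aeval x q - algebraMap k L (q.eval c)) < 1 := by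
  obtain ⟨r, hr⟩ := X_sub_C_dvd_sub_C_eval (a := c) (p := q)
  have h1 : aeval x q - algebraMap k L (q.eval c) =
      (x - algebraMap k L c) * aeval x r := by
    simpa using congrArg (aeval x) hr
  have hx1 : B.ring.valuation x ≤ 1 := by
    have := B.ring.valuation.map_add (x - algebraMap k L c) (algebraMap k L c)
    rw [sub_add_cancel] at this
    exact this.trans (max_le hx.le (B.valuation_algebraMap_le c))
  rw [h1, map_mul]
  exact mul_lt_one_of_lt_of_le hx (B.valuation_aeval_le hx1 r)

open Polynomial in
theorem valuation_aeval_eq_one {x : L} {c : k} (hx : B.ring.valuation (x - algebraMap k L c) < 1)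
    {q : k[X]} (hq : q.eval c ≠ 0) : B.ring.valuation (aeval x q) = 1 := by
  have h := B.ring.valuation.map_add_eq_of_lt_left
    ((B.valuation_aeval_sub_lt hx q).trans_eq (B.valuation_algebraMap hq).symm)
  rwa [add_sub_cancel, B.valuation_algebraMap hq] at h

end

end CurvePlace

/-! ### Tame charts and discreteness of the valuation. -/

open Polynomial in
/-- Coordinates at a place `B` of a tame extension `L` of `k(π)`: the unramified part is generated
by the `d`-th root `y` of a unit of `k[π]_(π)`, and `s` is a uniformizer of `B`. -/
structure TameChart {k L : Type u} [Field k] [Field L] [Algebra k L] (B : CurvePlace k L)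
    (π y s : L) (ζ : k) (a d e : ℕ) (h₁ h₂ : k[X]) : Prop where
  π_ne_zero : π ≠ 0
  valuation_π : B.ring.valuation π < 1
  ζ_ne_zero : ζ ≠ 0
  valuation_y_sub : B.ring.valuation (y - algebraMap k L ζ) < 1
  y_pow : y ^ d = aeval π h₁ / aeval π h₂
  eval_h₂ : h₂.eval 0 ≠ 0
  s_pow : s ^ e = y ^ a * π
  d_ne_zero : (d : k) ≠ 0
  e_ne_zero : (e : k) ≠ 0
  adjoin_eq_top : IntermediateField.adjoin k {π, y, s} = ⊤

namespace TameChart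

open Polynomial

variable {k L : Type u} [Field k] [Field L] [Algebra k L] {B : CurvePlace k L}
  {π y s : L} {ζ : k} {a d e : ℕ} {h₁ h₂ : k[X]} (H : TameChart B π y s ζ a d e h₁ h₂)

include H

theorem e_pos : e ≠ 0 := fun h => H.e_ne_zero (by rw [h, Nat.cast_zero])

theorem d_pos : d ≠ 0 := fun h => H.d_ne_zero (by rw [h, Nat.cast_zero])

theorem valuation_y : B.ring.valuation y = 1 := by
  simpa using B.valuation_aeval_eq_one H.valuation_y_sub (q := X) (by simpa using H.ζ_ne_zero)

theorem valuation_s_pow : B.ring.valuation s ^ e = B.ring.valuation π := by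
  rw [← map_pow, H.s_pow, map_mul, map_pow, H.valuation_y, one_pow, one_mul]

theorem valuation_s : B.ring.valuation s < 1 := by
  by_contra! h
  exact (one_le_pow₀ h).not_gt (H.valuation_s_pow.trans_lt H.valuation_π)

theorem y_ne_zero : y ≠ 0 := by
  rintro rfl
  simpa using H.valuation_y

theorem s_ne_zero : s ≠ 0 := by
  rintro rfl
  have := H.s_pow
  rw [zero_pow H.e_pos] at this
  exact mul_ne_zero (pow_ne_zero _ H.y_ne_zero) H.π_ne_zero this.symm

theorem valuation_π_sub : B.ring.valuation (π - algebraMap k L 0) < 1 := by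
  simpa using H.valuation_π

theorem valuation_aeval_h₂ : B.ring.valuation (aeval π h₂) = 1 :=
  B.valuation_aeval_eq_one H.valuation_π_sub H.eval_h₂

theorem aeval_h₂_ne_zero : aeval π h₂ ≠ 0 := by
  intro h
  simpa [h] using H.valuation_aeval_h₂

theorem valuation_le_of_mem_adjoin {r : L} (hr : r ∈ Algebra.adjoin k {π, y, s}) :
    B.ring.valuation r ≤ 1 := by
  induction hr using Algebra.adjoin_induction with
  | mem x hx =>
    rcases hx with rfl | rfl | rfl
    exacts [H.valuation_π.le, H.valuation_y.le, H.valuation_s.le]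
  | algebraMap c => exact B.valuation_algebraMap_le c
  | add x y _ _ hx hy => exact (B.ring.valuation.map_add _ _).trans (max_le hx hy)
  | mul x y _ _ hx hy => rw [map_mul]; exact mul_le_one' hx hy

/-- `y - ζ` is divisible by `π`. -/
theorem exists_y_sub_eq : ∃ q₁ q₂ : k[X], B.ring.valuation (aeval y q₂) = 1 ∧
    y - algebraMap k L ζ = π * aeval π q₁ / (aeval π h₂ * aeval y q₂) := by
  obtain ⟨q₂, hq₂⟩ : X - C ζ ∣ X ^ d - C (ζ ^ d) := by
    rw [C_pow]; exact sub_dvd_pow_sub_pow _ _ _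
  have hv : B.ring.valuation (aeval y q₂) = 1 := by
    refine B.valuation_aeval_eq_one H.valuation_y_sub ?_
    -- The cofactor takes at `ζ` the value `d ζ ^ (d - 1)` of the derivative of `X ^ d`, nonzero by
    -- tameness.
    have := congrArg (fun f => eval ζ (derivative f)) hq₂
    simp only [derivative_sub, derivative_X_pow, derivative_C, derivative_mul, derivative_X,
      eval_sub, eval_mul, eval_add, eval_X, eval_C, eval_pow, sub_self,
      sub_zero, zero_mul, add_zero, one_mul] at this
    rw [← this]
    exact mul_ne_zero H.d_ne_zero (pow_ne_zero _ H.ζ_ne_zero)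
  -- This constant is a difference of two elements of value less than `1`, and a nonzero constant
  -- has value `1`.
  have h0 : (h₁ - C (ζ ^ d) * h₂).eval 0 = 0 := by
    refine B.eq_zero_of_valuation_algebraMap_lt_one ?_
    have h3 := B.valuation_aeval_sub_lt H.valuation_π_sub (h₁ - C (ζ ^ d) * h₂)
    have h4 := B.valuation_aeval_sub_lt H.valuation_y_sub (X ^ d)
    have h5 : algebraMap k L ((h₁ - C (ζ ^ d) * h₂).eval 0) =
        aeval π h₂ * (aeval y (X ^ d : k[X]) - algebraMap k L ((X ^ d : k[X]).eval ζ)) -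
        (aeval π (h₁ - C (ζ ^ d) * h₂) - algebraMap k L ((h₁ - C (ζ ^ d) * h₂).eval 0)) := by
      have h6 : aeval π h₂ * y ^ d = aeval π h₁ := by
        rw [H.y_pow, mul_div_cancel₀ _ H.aeval_h₂_ne_zero]
      simp only [map_sub, map_mul, aeval_C, map_pow, aeval_X, eval_pow, eval_X]
      linear_combination -h6
    rw [h5]
    refine B.ring.valuation.map_sub_lt ?_ h3
    rw [map_mul, H.valuation_aeval_h₂, one_mul]
    exact h4
  obtain ⟨q₁, hq₁⟩ := X_dvd_iff.mpr ((coeff_zero_eq_eval_zero _).trans h0)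
  refine ⟨q₁, q₂, hv, ?_⟩
  have hq2 : aeval y q₂ ≠ 0 := by
    intro h
    simp [h] at hv
  have e1 := congrArg (aeval y) hq₂
  have e2 := congrArg (aeval π) hq₁
  have e3 := H.y_pow
  have := H.aeval_h₂_ne_zero
  simp only [map_sub, map_mul, map_pow, aeval_X, aeval_C] at e1 e2
  rw [eq_div_iff (mul_ne_zero this hq2)]
  rw [eq_div_iff this] at e3
  linear_combination (-aeval π h₂) * e1 + e3 + e2

end TameChart

namespace CurvePlace

variable {k L : Type u} [Field k] [Field L] [Algebra k L] (B : CurvePlace k L)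

/-- The center of a place on a subring contained in its valuation ring. -/
def center (R : Subring L) (hR : R ≤ B.ring.toSubring) : Ideal R :=
  (IsLocalRing.maximalIdeal B.ring).comap (Subring.inclusion hR)

instance (R : Subring L) (hR : R ≤ B.ring.toSubring) : (B.center R hR).IsPrime :=
  inferInstanceAs ((IsLocalRing.maximalIdeal B.ring).comap (Subring.inclusion hR)).IsPrime

theorem mem_center {R : Subring L} {hR : R ≤ B.ring.toSubring} {r : R} :
    r ∈ B.center R hR ↔ B.ring.valuation (r : L) < 1 :=
  B.ring.valuation_lt_one_iff (Subring.inclusion hR r)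

theorem notMem_center {R : Subring L} {hR : R ≤ B.ring.toSubring} {r : R} :
    r ∉ B.center R hR ↔ B.ring.valuation (r : L) = 1 := by
  rw [B.mem_center, not_lt]
  have h := (B.ring.valuation_le_one_iff _).mpr (hR r.2)
  exact ⟨fun h' => le_antisymm h h', fun h' => h'.ge⟩

theorem mem_ofPrime_center {R : Subring L} (hR : R ≤ B.ring.toSubring) {x : L} :
    x ∈ (LocalSubring.ofPrime R (B.center R hR)).toSubring ↔
      ∃ r ∈ R, ∃ r' ∈ R, B.ring.valuation r' = 1 ∧ x = r / r' := by
  set M := B.center R hR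
  constructor
  · intro hx
    obtain ⟨r, r', h⟩ := IsLocalization.exists_mk'_eq M.primeCompl
      (⟨x, hx⟩ : (LocalSubring.ofPrime R M).toSubring)
    rw [IsLocalization.mk'_eq_iff_eq_mul] at h
    have h1 : (r : L) = x * (r' : R) := congrArg Subtype.val h
    have h2 : B.ring.valuation ((r' : R) : L) = 1 := B.notMem_center.mp r'.2
    refine ⟨r, r.2, (r' : R), (r' : R).2, h2, ?_⟩
    rw [eq_div_iff (fun h0 => by simp [h0] at h2), h1]
  · rintro ⟨r, hr, r', hr', h, rfl⟩
    let q : M.primeCompl := ⟨⟨r', hr'⟩, B.notMem_center.mpr h⟩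
    have h1 := IsLocalization.mk'_spec (LocalSubring.ofPrime R M).toSubring (⟨r, hr⟩ : R) q
    have h2 : _ * r' = r := congrArg Subtype.val h1
    rw [← h2, mul_div_cancel_right₀ _ (fun h0 => by simp [h0] at h)]
    exact Subtype.property _

end CurvePlace

namespace TameChart

open Polynomial

variable {k L : Type u} [Field k] [Field L] [Algebra k L] {B : CurvePlace k L}
  {π y s : L} {ζ : k} {a d e : ℕ} {h₁ h₂ : k[X]} (H : TameChart B π y s ζ a d e h₁ h₂)

include H

/-- Every nonzero element is a power of `s` times a quotient of units from `k[π, y, s]`. -/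
theorem exists_eq_zpow_mul {b : L} (hb : b ≠ 0) :
    ∃ (m : ℤ), ∃ r ∈ Algebra.adjoin k {π, y, s}, ∃ r' ∈ Algebra.adjoin k {π, y, s},
      B.ring.valuation r = 1 ∧ B.ring.valuation r' = 1 ∧ b = s ^ m * (r / r') := by
  set A := Algebra.adjoin k ({π, y, s} : Set L) with hA
  have hR : A.toSubring ≤ B.ring.toSubring := fun r hr =>
    (B.ring.valuation_le_one_iff _).mp (H.valuation_le_of_mem_adjoin hr)
  have hπ : π ∈ A := Algebra.subset_adjoin (by simp)
  have hy : y ∈ A := Algebra.subset_adjoin (by simp)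
  have hs : s ∈ A := Algebra.subset_adjoin (by simp)
  -- `B` is not known to be discrete. The local ring `T` of `k[π, y, s]` at the center of `B` is
  -- Noetherian with maximal ideal generated by `s`, hence a discrete valuation ring; its fraction
  -- field is `L`, so its factorizations give the claim.
  set T := LocalSubring.ofPrime A.toSubring (B.center A.toSubring hR) with hT
  have memT : ∀ x, x ∈ T.toSubring ↔ ∃ r ∈ A, ∃ r' ∈ A, B.ring.valuation r' = 1 ∧ x = r / r' :=
    fun x => B.mem_ofPrime_center hR
  have hAT : ∀ x ∈ A, x ∈ T.toSubring := fun x hx =>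
    (memT x).mpr ⟨x, hx, 1, one_mem A, map_one _, (div_one x).symm⟩
  have aeval_mem : ∀ x ∈ A, ∀ q : k[X], aeval x q ∈ A := fun x hx q =>
    Algebra.adjoin_le (S := A) (Set.singleton_subset_iff.mpr hx) (aeval_mem_adjoin_singleton k x)
  have hle : ∀ x ∈ T.toSubring, B.ring.valuation x ≤ 1 := by
    intro x hx
    obtain ⟨r, hr, r', hr', h, rfl⟩ := (memT x).mp hx
    rw [map_div₀, h, div_one]
    exact H.valuation_le_of_mem_adjoin hr
  have hinv : ∀ x ∈ T.toSubring, B.ring.valuation x = 1 → x⁻¹ ∈ T.toSubring := by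
    intro x hx hx1
    obtain ⟨r, hr, r', hr', h, rfl⟩ := (memT x).mp hx
    rw [map_div₀, h, div_one] at hx1
    exact (memT _).mpr ⟨r', hr', r, hr, hx1, inv_div _ _⟩
  obtain ⟨q, hq⟩ : ∃ q, e = q + 1 := Nat.exists_eq_succ_of_ne_zero H.e_pos
  have hπs : ∃ t ∈ T.toSubring, π = s * t := by
    refine ⟨s ^ q * (y ^ a)⁻¹, T.toSubring.mul_mem (pow_mem (hAT _ hs) _)
      (hinv _ (pow_mem (hAT _ hy) _) ?_), ?_⟩
    · rw [map_pow, H.valuation_y, one_pow]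
    · have := H.s_pow
      have h0 := pow_ne_zero a H.y_ne_zero
      rw [hq] at this
      field_simp
      linear_combination -this
  -- `T = k + s T`. On generators: `π` and `s` lie in `s T`, and `y - ζ` is in `π T`. Quotients
  -- follow since the constant part of a unit denominator is nonzero.
  have hres : ∀ x ∈ T.toSubring, ∃ c : k, ∃ t ∈ T.toSubring, x = algebraMap k L c + s * t := by
    have hresA : ∀ x ∈ A, ∃ c : k, ∃ t ∈ T.toSubring, x = algebraMap k L c + s * t := by
      intro x hx
      obtain ⟨t, ht, hst⟩ := hπs
      induction hx using Algebra.adjoin_induction with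
      | mem x hx =>
        rcases hx with rfl | rfl | rfl
        · exact ⟨0, t, ht, by rw [map_zero, zero_add, hst]⟩
        · obtain ⟨q₁, q₂, hq₂, h⟩ := H.exists_y_sub_eq
          refine ⟨ζ, t * (aeval π q₁ / (aeval π h₂ * aeval x q₂)), T.toSubring.mul_mem ht
            ((memT _).mpr ⟨_, aeval_mem _ hπ _, _, A.mul_mem (aeval_mem _ hπ _) (aeval_mem _ hy _),
              ?_, rfl⟩), ?_⟩
          · rw [map_mul, H.valuation_aeval_h₂, hq₂, one_mul]
          · rw [← mul_assoc, ← hst, ← mul_div_assoc, ← h, add_sub_cancel]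
        · exact ⟨0, 1, one_mem _, by rw [map_zero, zero_add, mul_one]⟩
      | algebraMap c => exact ⟨c, 0, zero_mem _, by rw [mul_zero, add_zero]⟩
      | add x y _ _ hx hy =>
        obtain ⟨c₁, t₁, ht₁, rfl⟩ := hx
        obtain ⟨c₂, t₂, ht₂, rfl⟩ := hy
        exact ⟨c₁ + c₂, t₁ + t₂, add_mem ht₁ ht₂, by rw [map_add]; ring⟩
      | mul x y hxA _ hx hy =>
        obtain ⟨c₂, t₂, ht₂, rfl⟩ := hy
        have hxT := hAT x hxA
        obtain ⟨c₁, t₁, ht₁, rfl⟩ := hx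
        refine ⟨c₁ * c₂, t₁ * algebraMap k L c₂ + (algebraMap k L c₁ + s * t₁) * t₂,
          add_mem (mul_mem ht₁ (hAT _ (A.algebraMap_mem c₂))) (mul_mem hxT ht₂), ?_⟩
        rw [map_mul]
        ring
    intro x hx
    obtain ⟨r, hr, r', hr', h, rfl⟩ := (memT x).mp hx
    obtain ⟨c, t, ht, hrt⟩ := hresA r hr
    obtain ⟨c', t', ht', hrt'⟩ := hresA r' hr'
    have hr'0 : r' ≠ 0 := fun h0 => by simp [h0] at h
    have hc' : c' ≠ 0 := by
      rintro rfl
      rw [hrt', map_zero, zero_add, map_mul] at h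
      exact (mul_lt_one_of_lt_of_le H.valuation_s (hle t' ht')).ne h
    have hc'0 : algebraMap k L c' ≠ 0 := by simpa using hc'
    refine ⟨c / c', (t * algebraMap k L c' - algebraMap k L c * t') *
      (algebraMap k L c' * r')⁻¹, mul_mem (sub_mem (mul_mem ht (hAT _ (A.algebraMap_mem _)))
        (mul_mem (hAT _ (A.algebraMap_mem _)) ht')) (hinv _ (hAT _ (A.mul_mem
          (A.algebraMap_mem _) hr')) ?_), ?_⟩
    · rw [map_mul, h, B.valuation_algebraMap hc', one_mul]
    · rw [map_div₀]
      field_simp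
      rw [hrt, hrt']
      ring
  have hlt : ∀ x ∈ T.toSubring, B.ring.valuation x < 1 → ∃ t ∈ T.toSubring, x = s * t := by
    intro x hx hx1
    obtain ⟨c, t, ht, rfl⟩ := hres x hx
    have hc : c = 0 := by
      refine B.eq_zero_of_valuation_algebraMap_lt_one ?_
      rw [← add_sub_cancel_right (algebraMap k L c) (s * t)]
      refine B.ring.valuation.map_sub_lt hx1 ?_
      rw [map_mul]
      exact mul_lt_one_of_lt_of_le H.valuation_s (hle t ht)
    exact ⟨t, ht, by rw [hc, map_zero, zero_add]⟩
  have : IsNoetherianRing A := by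
    classical
    have : Algebra.FiniteType k A :=
      (Subalgebra.fg_iff_finiteType A).mp ⟨({π, y, s} : Finset L), by simp [hA]⟩
    exact Algebra.FiniteType.isNoetherianRing k A
  have : IsNoetherianRing A.toSubring := this
  have : IsNoetherianRing T.toSubring :=
    IsLocalization.isNoetherianRing (B.center A.toSubring hR).primeCompl _ ‹_›
  have := T.isLocalRing
  have unit_iff : ∀ x : T.toSubring, IsUnit x ↔ B.ring.valuation (x : L) = 1 := by
    intro x
    constructor
    · rintro ⟨u, rfl⟩
      have h1 := hle _ u.1.2
      have h2 := hle _ u⁻¹.1.2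
      have h3 := congrArg (fun x : T.toSubring => B.ring.valuation (x : L)) u.mul_inv
      simp only [Subring.coe_mul, map_mul, Subring.coe_one, map_one] at h3
      exact le_antisymm h1 (h3.symm.trans_le (mul_le_of_le_one_right' h2))
    · intro h
      exact isUnit_iff_exists_inv.mpr ⟨⟨_, hinv x x.2 h⟩, Subtype.ext
        (mul_inv_cancel₀ (fun h0 => by simp [h0] at h))⟩
  let σ : T.toSubring := ⟨s, hAT s hs⟩
  have hmax : IsLocalRing.maximalIdeal T.toSubring = Ideal.span {σ} := by
    ext x
    rw [IsLocalRing.mem_maximalIdeal, mem_nonunits_iff, unit_iff, Ideal.mem_span_singleton]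
    constructor
    · intro hx
      obtain ⟨t, ht, h⟩ := hlt x x.2 (lt_of_le_of_ne (hle x x.2) hx)
      exact ⟨⟨t, ht⟩, Subtype.ext h⟩
    · rintro ⟨t, rfl⟩
      refine ne_of_lt ?_
      change B.ring.valuation (s * t) < 1
      rw [map_mul]
      exact mul_lt_one_of_lt_of_le H.valuation_s (hle t t.2)
  have hfield : ¬ IsField T.toSubring := by
    intro h
    rw [IsLocalRing.isField_iff_maximalIdeal_eq, hmax, Ideal.span_singleton_eq_bot] at h
    exact H.s_ne_zero (congrArg Subtype.val h)
  have hprin : (IsLocalRing.maximalIdeal T.toSubring).IsPrincipal := ⟨σ, hmax⟩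
  have : IsDiscreteValuationRing T.toSubring :=
    ((IsDiscreteValuationRing.TFAE T.toSubring hfield).out 4 0).mp hprin
  have hσ : Irreducible σ :=
    (IsDiscreteValuationRing.irreducible_iff_uniformizer σ).mpr hmax
  have hfac : ∀ x ∈ T.toSubring, x ≠ 0 → ∃ (m : ℕ) (w : L), w ∈ T.toSubring ∧
      B.ring.valuation w = 1 ∧ x = s ^ m * w := by
    intro x hx hx0
    obtain ⟨m, u, hu⟩ := IsDiscreteValuationRing.eq_unit_mul_pow_irreducible
      (x := (⟨x, hx⟩ : T.toSubring)) (fun h => hx0 (congrArg Subtype.val h)) hσ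
    refine ⟨m, u.1, u.1.2, (unit_iff _).mp u.isUnit, ?_⟩
    rw [mul_comm]
    exact congrArg Subtype.val hu
  have hfrac : ∃ x₁ ∈ T.toSubring, ∃ x₂ ∈ T.toSubring, x₂ ≠ 0 ∧ b = x₁ / x₂ := by
    have hmem : b ∈ IntermediateField.adjoin k {π, y, s} := by
      rw [H.adjoin_eq_top]; exact IntermediateField.mem_top
    obtain ⟨r, hr, r', hr', rfl⟩ := IntermediateField.mem_adjoin_iff_div.mp hmem
    exact ⟨r, hAT r hr, r', hAT r' hr', fun h => hb (by rw [h, div_zero]), rfl⟩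
  obtain ⟨x₁, hx₁, x₂, hx₂, hx₂0, rfl⟩ := hfrac
  obtain ⟨m₁, w₁, hw₁, hv₁, rfl⟩ := hfac x₁ hx₁ (fun h => hb (by rw [h, zero_div]))
  obtain ⟨m₂, w₂, hw₂, hv₂, rfl⟩ := hfac x₂ hx₂ hx₂0
  obtain ⟨r, hr, r', hr', h, hw⟩ := (memT (w₁ / w₂)).mp (by
    rw [div_eq_mul_inv]
    exact T.toSubring.mul_mem hw₁ (hinv _ hw₂ hv₂))
  have hv : B.ring.valuation r = 1 := by
    have := congrArg B.ring.valuation hw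
    rw [map_div₀, map_div₀, hv₁, hv₂, h] at this
    simpa using this.symm
  refine ⟨m₁ - m₂, r, hr, r', hr', hv, h, ?_⟩
  rw [← hw, zpow_sub₀ H.s_ne_zero, zpow_natCast, zpow_natCast, mul_div_mul_comm]

end TameChart

/-! ### Differentials and stabilizers in a tame chart. -/

namespace TameChart

open Polynomial

variable {k L : Type u} [Field k] [Field L] [Algebra k L] {B : CurvePlace k L}
  {π y s : L} {ζ : k} {a d e : ℕ} {h₁ h₂ : k[X]} (H : TameChart B π y s ζ a d e h₁ h₂)

include H

theorem valuation_zpow_eq_one_iff {m : ℤ} : B.ring.valuation (s ^ m) = 1 ↔ m = 0 := by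
  rw [map_zpow₀, zpow_eq_one_iff_right₀ zero_le H.valuation_s.ne]

theorem valuation_zpow_le_one_iff {m : ℤ} : B.ring.valuation (s ^ m) ≤ 1 ↔ 0 ≤ m := by
  rw [map_zpow₀]
  have h0 : 0 < B.ring.valuation s := zero_lt_iff.mpr (by simpa using H.s_ne_zero)
  rw [zpow_le_one_iff_right_of_lt_one₀ h0 H.valuation_s]

/-- Differentiate `y ^ d * h₂(π) = h₁(π)`: the coefficient `d y ^ (d - 1) h₂(π)` of `dy` is a unit
because `d` is nonzero in `k`. -/
theorem exists_D_y_eq : ∃ c : L, B.ring.valuation c ≤ 1 ∧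
    KaehlerDifferential.D k L y = c • KaehlerDifferential.D k L π := by
  have hd : algebraMap k L d ≠ 0 :=
    (map_ne_zero (algebraMap k L)).mpr H.d_ne_zero
  have h2 := H.aeval_h₂_ne_zero
  have hy := pow_ne_zero (d - 1) H.y_ne_zero
  have h := H.y_pow
  rw [eq_div_iff h2] at h
  have h' := congrArg (KaehlerDifferential.D k L) h
  rw [Derivation.leibniz, Derivation.leibniz_pow, Derivation.map_aeval, Derivation.map_aeval] at h'
  refine ⟨(aeval π (derivative h₁) - y ^ d * aeval π (derivative h₂)) /
    (algebraMap k L d * y ^ (d - 1) * aeval π h₂), ?_, ?_⟩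
  · rw [map_div₀, map_mul, map_mul, B.valuation_algebraMap H.d_ne_zero, map_pow, H.valuation_y,
      H.valuation_aeval_h₂, one_pow, one_mul, one_mul, div_one]
    refine B.ring.valuation.map_sub_le (B.valuation_aeval_le H.valuation_π.le _) ?_
    rw [map_mul, map_pow, H.valuation_y, one_pow, one_mul]
    exact B.valuation_aeval_le H.valuation_π.le _
  · have hD : (algebraMap k L d * y ^ (d - 1) * aeval π h₂) • KaehlerDifferential.D k L y =
        (aeval π (derivative h₁) - y ^ d * aeval π (derivative h₂)) •
          KaehlerDifferential.D k L π := by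
      rw [sub_smul, ← h', mul_smul (y ^ d), add_sub_cancel_left, map_natCast, mul_comm, mul_smul,
        mul_smul, Nat.cast_smul_eq_nsmul]
    rw [div_eq_inv_mul, mul_smul, ← hD, smul_smul,
      inv_mul_cancel₀ (mul_ne_zero (mul_ne_zero hd hy) h2), one_smul]

/-- Differentiate `s ^ e = y ^ a π`. As `dy` is an integral multiple of `dπ`, the right side becomes
`w dπ` with `w` congruent to the unit `y ^ a`; on the left, `e` is a unit. The exponent `e - 1` is
that of the tame different. -/
theorem exists_D_π_eq : ∃ c : L, B.ring.valuation c = 1 ∧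
    KaehlerDifferential.D k L π = (c * s ^ (e - 1)) • KaehlerDifferential.D k L s := by
  obtain ⟨c, hc, hDy⟩ := H.exists_D_y_eq
  have h' := congrArg (KaehlerDifferential.D k L) H.s_pow
  rw [Derivation.leibniz, Derivation.leibniz_pow, Derivation.leibniz_pow, hDy,
    ← Nat.cast_smul_eq_nsmul L, ← Nat.cast_smul_eq_nsmul L, smul_smul, smul_smul, smul_smul,
    smul_smul, ← add_smul] at h'
  set w := y ^ a + π * ((a : L) * (y ^ (a - 1) * c)) with hw
  have hw' : y ^ a + π * a * y ^ (a - 1) * c = w := by rw [hw]; ring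
  rw [hw'] at h'
  have hle : B.ring.valuation ((a : L) * (y ^ (a - 1) * c)) ≤ 1 := by
    rw [map_mul, map_mul, map_pow, H.valuation_y, one_pow, one_mul, ← map_natCast (algebraMap k L)]
    exact mul_le_one' (B.valuation_algebraMap_le _) hc
  have hvw : B.ring.valuation w = 1 := by
    have hy : B.ring.valuation (y ^ a) = 1 := by rw [map_pow, H.valuation_y, one_pow]
    rw [hw, B.ring.valuation.map_add_eq_of_lt_left, hy]
    rw [hy, map_mul]
    exact mul_lt_one_of_lt_of_le H.valuation_π hle
  have hw0 : w ≠ 0 := fun h => by simp [h] at hvw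
  refine ⟨e / w, ?_, ?_⟩
  · rw [map_div₀, hvw, div_one, ← map_natCast (algebraMap k L)]
    exact B.valuation_algebraMap H.e_ne_zero
  · rw [div_eq_inv_mul, mul_assoc, mul_smul, h', smul_smul, inv_mul_cancel₀ hw0, one_smul]

/-- The derivation `d / ds` preserves the local ring at `B`. -/
theorem exists_D_eq {b : L} (hb : B.ring.valuation b ≤ 1) : ∃ c : L, B.ring.valuation c ≤ 1 ∧
    KaehlerDifferential.D k L b = c • KaehlerDifferential.D k L s := by
  have hs := H.valuation_s
  have hmul : ∀ x y : L, B.ring.valuation x ≤ 1 → B.ring.valuation y ≤ 1 →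
      (∃ c : L, B.ring.valuation c ≤ 1 ∧
        KaehlerDifferential.D k L x = c • KaehlerDifferential.D k L s) →
      (∃ c : L, B.ring.valuation c ≤ 1 ∧
        KaehlerDifferential.D k L y = c • KaehlerDifferential.D k L s) →
      ∃ c : L, B.ring.valuation c ≤ 1 ∧
        KaehlerDifferential.D k L (x * y) = c • KaehlerDifferential.D k L s := by
    rintro x y hx hy ⟨c₁, h₁, e₁⟩ ⟨c₂, h₂, e₂⟩
    refine ⟨x * c₂ + y * c₁, (B.ring.valuation.map_add _ _).trans (max_le ?_ ?_), ?_⟩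
    · rw [map_mul]; exact mul_le_one' hx h₂
    · rw [map_mul]; exact mul_le_one' hy h₁
    · rw [Derivation.leibniz, e₁, e₂, smul_smul, smul_smul, add_smul]
  have hπ : ∃ c : L, B.ring.valuation c ≤ 1 ∧
      KaehlerDifferential.D k L π = c • KaehlerDifferential.D k L s := by
    obtain ⟨c, hc, h⟩ := H.exists_D_π_eq
    refine ⟨_, ?_, h⟩
    rw [map_mul, hc, one_mul, map_pow]
    exact pow_le_one₀ zero_le hs.le
  have hadj : ∀ r ∈ Algebra.adjoin k {π, y, s}, ∃ c : L, B.ring.valuation c ≤ 1 ∧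
      KaehlerDifferential.D k L r = c • KaehlerDifferential.D k L s := by
    intro r hr
    induction hr using Algebra.adjoin_induction with
    | mem x hx =>
      rcases hx with rfl | rfl | rfl
      · exact hπ
      · obtain ⟨c, hc, h⟩ := hπ
        obtain ⟨c', hc', h'⟩ := H.exists_D_y_eq
        refine ⟨c' * c, ?_, by rw [h', h, smul_smul]⟩
        rw [map_mul]; exact mul_le_one' hc' hc
      · exact ⟨1, (map_one _).le, (one_smul _ _).symm⟩
    | algebraMap c => exact ⟨0, by simp, by simp⟩
    | add x y _ _ hx hy =>
      obtain ⟨c₁, h₁, e₁⟩ := hx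
      obtain ⟨c₂, h₂, e₂⟩ := hy
      exact ⟨c₁ + c₂, (B.ring.valuation.map_add _ _).trans (max_le h₁ h₂), by
        rw [map_add, e₁, e₂, add_smul]⟩
    | mul x y hx' hy' hx hy =>
      exact hmul x y (H.valuation_le_of_mem_adjoin hx') (H.valuation_le_of_mem_adjoin hy') hx hy
  by_cases hb0 : b = 0
  · exact ⟨0, by simp, by simp [hb0]⟩
  -- Integral elements are `s ^ m r / r'` with `m ≥ 0` and `r, r'` units of `k[π, y, s]`, so the
  -- product and quotient rules finish.
  obtain ⟨m, r, hr, r', hr', hv, hv', rfl⟩ := H.exists_eq_zpow_mul hb0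
  have hm : 0 ≤ m := by
    rwa [map_mul, map_div₀, hv, hv', div_one, mul_one, H.valuation_zpow_le_one_iff] at hb
  lift m to ℕ using hm
  have hinv : ∃ c : L, B.ring.valuation c ≤ 1 ∧
      KaehlerDifferential.D k L r'⁻¹ = c • KaehlerDifferential.D k L s := by
    obtain ⟨c, hc, h⟩ := hadj r' hr'
    refine ⟨-r'⁻¹ ^ 2 * c, ?_, by rw [Derivation.leibniz_inv, h, smul_smul]⟩
    rw [map_mul, Valuation.map_neg, map_pow, map_inv₀, hv', inv_one, one_pow, one_mul]
    exact hc
  have hsm : s ^ m ∈ Algebra.adjoin k {π, y, s} := pow_mem (Algebra.subset_adjoin (by simp)) m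
  rw [zpow_natCast, div_eq_mul_inv]
  have hv'' : B.ring.valuation r'⁻¹ ≤ 1 := by rw [map_inv₀, hv', inv_one]
  refine hmul _ _ (H.valuation_le_of_mem_adjoin hsm) ?_ (hadj _ hsm)
    (hmul _ _ hv.le hv'' (hadj r hr) hinv)
  rw [map_mul, hv, one_mul]
  exact hv''

end TameChart

namespace TameChart

open Polynomial

variable {k L : Type u} [Field k] [Field L] [Algebra k L] {B : CurvePlace k L}
  {π y s : L} {ζ : k} {a d e : ℕ} {h₁ h₂ : k[X]} (H : TameChart B π y s ζ a d e h₁ h₂)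

include H

theorem s_mem : s ∈ B.ring := (B.ring.valuation_le_one_iff _).mp H.valuation_s.le

/-- Every nonzero element of the local ring is a power of `s` times a unit. -/
theorem exists_eq_pow_mul (b : B.ring) (hb : b ≠ 0) : ∃ (m : ℕ) (w : B.ring), IsUnit w ∧
    b = (⟨s, H.s_mem⟩ : B.ring) ^ m * w := by
  obtain ⟨m, r, -, r', -, hv, hv', h⟩ := H.exists_eq_zpow_mul (b := (b : L))
    (fun h => hb (Subtype.ext h))
  have hvw : B.ring.valuation (r / r') = 1 := by rw [map_div₀, hv, hv', div_one]
  have hm : 0 ≤ m := by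
    have := (B.ring.valuation_le_one_iff _).mpr b.2
    rwa [h, map_mul, hvw, mul_one, H.valuation_zpow_le_one_iff] at this
  lift m to ℕ using hm
  refine ⟨m, ⟨r / r', (B.ring.valuation_le_one_iff _).mp hvw.le⟩,
    (B.ring.valuation_eq_one_iff _).mpr hvw, Subtype.ext ?_⟩
  rw [h, zpow_natCast]
  rfl

theorem not_isUnit_s : ¬ IsUnit (⟨s, H.s_mem⟩ : B.ring) := fun h =>
  H.valuation_s.ne ((B.ring.valuation_eq_one_iff _).mp h)

theorem irreducible_s : Irreducible (⟨s, H.s_mem⟩ : B.ring) := by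
  refine ⟨H.not_isUnit_s, fun {x x'} h => ?_⟩
  have hs0 : (⟨s, H.s_mem⟩ : B.ring) ≠ 0 := fun h => H.s_ne_zero (congrArg Subtype.val h)
  obtain ⟨m, w, hw, hx⟩ := H.exists_eq_pow_mul x (fun h0 => hs0 (by rw [h, h0, zero_mul]))
  obtain ⟨m', w', hw', hx'⟩ := H.exists_eq_pow_mul x' (fun h0 => hs0 (by rw [h, h0, mul_zero]))
  rcases m with _ | m
  · left; rwa [hx, pow_zero, one_mul]
  rcases m' with _ | m'
  · right; rwa [hx', pow_zero, one_mul]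
  exfalso
  refine H.not_isUnit_s (isUnit_iff_exists_inv.mpr
    ⟨(⟨s, H.s_mem⟩ : B.ring) ^ m * w * ((⟨s, H.s_mem⟩ : B.ring) ^ m' * w'), ?_⟩)
  refine mul_left_cancel₀ hs0 ?_
  rw [mul_one]
  refine Eq.trans ?_ h.symm
  rw [hx, hx']
  ring

theorem exists_eq_mul_of_irreducible {x : B.ring} (hx : Irreducible x) :
    ∃ w : L, B.ring.valuation w = 1 ∧ (x : L) = s * w := by
  obtain ⟨m, w, hw, h⟩ := H.exists_eq_pow_mul x hx.ne_zero
  rcases m with _ | m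
  · rw [pow_zero, one_mul] at h
    exact absurd (h ▸ hw) hx.not_isUnit
  have hu : IsUnit ((⟨s, H.s_mem⟩ : B.ring) ^ m * w) := by
    refine (hx.isUnit_or_isUnit ?_).resolve_left H.not_isUnit_s
    rw [h]
    ring
  refine ⟨_, (B.ring.valuation_eq_one_iff _).mp hu, ?_⟩
  rw [h, pow_succ', mul_assoc]
  rfl

/-- Any uniformizer is `s w` with `w` a unit, and `d(s w) = (w + s c) ds` with `c` integral, so `w +
s c` is again a unit. Hence one uniformizer suffices to test the order. -/
theorem hasOrd_iff {ω : Ω[L⁄k]} {n : ℤ} : B.HasOrd ω n ↔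
    ∃ g : L, B.ring.valuation g = 1 ∧ ω = (g * s ^ n) • KaehlerDifferential.D k L s := by
  constructor
  · rintro ⟨x, g, hx, hg, rfl⟩
    obtain ⟨w, hw, hxw⟩ := H.exists_eq_mul_of_irreducible hx
    obtain ⟨c, hc, hD⟩ := H.exists_D_eq hw.le
    refine ⟨g * w ^ n * (w + s * c), ?_, ?_⟩
    · have h1 : B.ring.valuation (w + s * c) = 1 := by
        rw [B.ring.valuation.map_add_eq_of_lt_left, hw]
        rw [hw, map_mul]
        exact mul_lt_one_of_lt_of_le H.valuation_s hc
      rw [map_mul, map_mul, map_zpow₀, hw, h1, (B.ring.valuation_eq_one_iff _).mp hg, one_zpow,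
        one_mul, one_mul]
    · rw [hxw, Derivation.leibniz, hD, smul_smul, ← add_smul, smul_smul, mul_zpow]
      congr 1
      ring
  · rintro ⟨g, hg, rfl⟩
    exact ⟨⟨s, H.s_mem⟩, ⟨g, (B.ring.valuation_le_one_iff _).mp hg.le⟩, H.irreducible_s,
      (B.ring.valuation_eq_one_iff _).mpr hg, rfl⟩

/-- `ord` only selects some admissible exponent, so uniqueness is needed: two exponents would make a
nontrivial power of `s` a unit. -/
theorem ord_eq {ω : Ω[L⁄k]} (hω : ω ≠ 0) {n : ℤ} (h : B.HasOrd ω n) : B.ord ω = n := by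
  have h' : B.HasOrd ω (B.ord ω) := Classical.epsilon_spec (p := fun n : ℤ => B.HasOrd ω n) ⟨n, h⟩
  generalize B.ord ω = m at h'
  obtain ⟨g, hg, e₁⟩ := H.hasOrd_iff.mp h
  obtain ⟨g', hg', e₂⟩ := H.hasOrd_iff.mp h'
  have hs : KaehlerDifferential.D k L s ≠ 0 := by
    intro h0
    exact hω (by rw [e₁, h0, smul_zero])
  have h1 : g * s ^ n = g' * s ^ m := smul_left_injective L hs (e₁.symm.trans e₂)
  have h2 : B.ring.valuation (s ^ (m - n)) = 1 := by
    have := congrArg B.ring.valuation h1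
    rw [map_mul, map_mul, hg, hg', one_mul, one_mul] at this
    rw [zpow_sub₀ H.s_ne_zero, map_div₀, this, div_self]
    rw [ne_eq, Valuation.zero_iff]
    exact zpow_ne_zero _ H.s_ne_zero
  rw [H.valuation_zpow_eq_one_iff] at h2
  omega

theorem ord_smul_D_π {ω : Ω[L⁄k]} (hω : ω ≠ 0) {g : L} (hg : B.ring.valuation g = 1) {n : ℤ}
    (h : ω = (g * s ^ n) • KaehlerDifferential.D k L π) : B.ord ω = n + e - 1 := by
  refine H.ord_eq hω (H.hasOrd_iff.mpr ?_)
  obtain ⟨c, hc, hD⟩ := H.exists_D_π_eq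
  refine ⟨g * c, by rw [map_mul, hg, hc, one_mul], ?_⟩
  rw [h, hD, smul_smul, add_sub_assoc, zpow_add₀ H.s_ne_zero]
  have : s ^ (e - 1) = s ^ ((e : ℤ) - 1) := by
    rw [← zpow_natCast, Nat.cast_sub (Nat.one_le_iff_ne_zero.mpr H.e_pos), Nat.cast_one]
  rw [this]
  congr 1
  ring

/-- An automorphism fixing the place preserves the residue `ζ` of `y`, and `τ y` has residue `η ζ`.
Conversely, if `η = 1`, then `τ` preserves the residues of `π, y, s`, hence units of `k[π, y, s]`,
and multiplies `s` by a constant, so it preserves the valuation. -/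
theorem mem_decompositionSubgroup_iff {K : Type u} [Field K] [Algebra k K] [Algebra K L]
    [IsScalarTower k K L] {τ : L ≃ₐ[K] L} (hπ : τ π = π) {η η' : k} (hη' : η' ≠ 0)
    (hy : τ y = algebraMap k L η * y) (hs : τ s = algebraMap k L η' * s) :
    τ ∈ B.ring.decompositionSubgroup K ↔ η = 1 := by
  have hk : ∀ c : k, τ (algebraMap k L c) = algebraMap k L c := fun c => by
    rw [IsScalarTower.algebraMap_apply k K L, τ.commutes]
  constructor
  · intro hτ
    have hτ' : τ • B.ring = B.ring := hτ
    have hmem : ∀ x, τ x ∈ B.ring ↔ x ∈ B.ring := fun x => by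
      conv_lhs => rw [← hτ']
      exact ValuationSubring.smul_mem_pointwise_smul_iff
    have h1 : B.ring.valuation (τ (y - algebraMap k L ζ)) < 1 := by
      by_contra! h
      have h0 : y - algebraMap k L ζ ≠ 0 := by
        intro h0
        simp [h0] at h
      have h2 : B.ring.valuation (τ (y - algebraMap k L ζ)⁻¹) ≤ 1 := by
        rw [map_inv₀, map_inv₀]
        exact inv_le_one_of_one_le₀ h
      rw [B.ring.valuation_le_one_iff, hmem, ← B.ring.valuation_le_one_iff, map_inv₀] at h2
      have h3 : 0 < B.ring.valuation (y - algebraMap k L ζ) := zero_lt_iff.mpr (by simpa using h0)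
      exact ((inv_le_one₀ h3).mp h2).not_gt H.valuation_y_sub
    rw [map_sub, hk, hy] at h1
    have h2 : B.ring.valuation (algebraMap k L (ζ * (η - 1))) < 1 := by
      have : algebraMap k L (ζ * (η - 1)) = (algebraMap k L η * y - algebraMap k L ζ) -
          algebraMap k L η * (y - algebraMap k L ζ) := by
        rw [map_mul, map_sub, map_one]
        ring
      rw [this]
      refine B.ring.valuation.map_sub_lt h1 ?_
      rw [map_mul, mul_comm]
      exact mul_lt_one_of_lt_of_le H.valuation_y_sub (B.valuation_algebraMap_le _)
    have h3 := B.eq_zero_of_valuation_algebraMap_lt_one h2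
    exact sub_eq_zero.mp ((mul_eq_zero.mp h3).resolve_left H.ζ_ne_zero)
  · rintro rfl
    rw [map_one, one_mul] at hy
    have hres : ∀ r ∈ Algebra.adjoin k {π, y, s}, ∃ c : k,
        B.ring.valuation (r - algebraMap k L c) < 1 ∧
        B.ring.valuation (τ r - algebraMap k L c) < 1 := by
      intro r hr
      induction hr using Algebra.adjoin_induction with
      | mem x hx =>
        rcases hx with rfl | rfl | rfl
        · exact ⟨0, H.valuation_π_sub, by rw [hπ]; exact H.valuation_π_sub⟩
        · exact ⟨ζ, H.valuation_y_sub, by rw [hy]; exact H.valuation_y_sub⟩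
        · refine ⟨0, by simpa using H.valuation_s, ?_⟩
          rw [hs, map_zero, sub_zero, map_mul, B.valuation_algebraMap hη', one_mul]
          exact H.valuation_s
      | algebraMap c => exact ⟨c, by simp, by simp [hk]⟩
      | add x x' _ _ hx hx' =>
        obtain ⟨c, h, h'⟩ := hx
        obtain ⟨c', g, g'⟩ := hx'
        refine ⟨c + c', ?_, ?_⟩
        · rw [map_add, add_sub_add_comm]
          exact B.ring.valuation.map_add_lt h g
        · rw [map_add, map_add, add_sub_add_comm]
          exact B.ring.valuation.map_add_lt h' g'
      | mul x x' _ hxA hx hx' =>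
        obtain ⟨c, h, h'⟩ := hx
        obtain ⟨c', g, g'⟩ := hx'
        have aux : ∀ u u' : L, B.ring.valuation (u - algebraMap k L c) < 1 →
            B.ring.valuation (u' - algebraMap k L c') < 1 →
            B.ring.valuation (u * u' - algebraMap k L (c * c')) < 1 := by
          intro u u' hu hu'
          have hu'1 : B.ring.valuation u' ≤ 1 := by
            rw [← sub_add_cancel u' (algebraMap k L c')]
            exact (B.ring.valuation.map_add _ _).trans
              (max_le hu'.le (B.valuation_algebraMap_le _))
          have : u * u' - algebraMap k L (c * c') =
              (u - algebraMap k L c) * u' + algebraMap k L c * (u' - algebraMap k L c') := by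
            rw [map_mul]; ring
          rw [this]
          refine B.ring.valuation.map_add_lt ?_ ?_
          · rw [map_mul]; exact mul_lt_one_of_lt_of_le hu hu'1
          · rw [map_mul, mul_comm]; exact mul_lt_one_of_lt_of_le hu' (B.valuation_algebraMap_le _)
        exact ⟨c * c', aux x x' h g, by rw [map_mul]; exact aux _ _ h' g'⟩
    have hunit : ∀ r ∈ Algebra.adjoin k {π, y, s}, B.ring.valuation r = 1 →
        B.ring.valuation (τ r) = 1 := by
      intro r hr h
      obtain ⟨c, h1, h2⟩ := hres r hr
      have hc : c ≠ 0 := by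
        rintro rfl
        rw [map_zero, sub_zero] at h1
        exact h1.ne h
      have h3 := B.ring.valuation.map_add_eq_of_lt_left (h2.trans_eq (B.valuation_algebraMap hc).symm)
      rwa [add_sub_cancel, B.valuation_algebraMap hc] at h3
    have hval : ∀ b, B.ring.valuation (τ b) = B.ring.valuation b := by
      intro b
      by_cases hb : b = 0
      · rw [hb, map_zero]
      obtain ⟨m, r, hr, r', hr', hv, hv', rfl⟩ := H.exists_eq_zpow_mul hb
      rw [map_mul, map_div₀, map_zpow₀, hs]
      simp only [map_mul, map_div₀, map_zpow₀, hunit r hr hv, hunit r' hr' hv', hv, hv',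
        B.valuation_algebraMap hη', one_mul]
    change τ • B.ring = B.ring
    ext x
    obtain ⟨x, rfl⟩ := τ.surjective x
    have : τ x ∈ τ • B.ring ↔ x ∈ B.ring := ValuationSubring.smul_mem_pointwise_smul_iff
    rw [this, ← B.ring.valuation_le_one_iff, ← B.ring.valuation_le_one_iff, hval]

end TameChart

/-! ### Places of Kummer extensions and the local value of `σ`. -/

open Polynomial in
/-- A place of a field over an algebraically closed field `k` sends every element which is integral
over `k` at the place to `k`. -/
theorem CurvePlace.exists_root_valuation_sub_lt_one {k L : Type u} [Field k] [Field L] [Algebra k L]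
    [IsAlgClosed k] (B : CurvePlace k L) {y : L} {q : k[X]} (hq : q.Monic)
    (h : B.ring.valuation (aeval y q) < 1) :
    ∃ ζ : k, B.ring.valuation (y - algebraMap k L ζ) < 1 := by
  by_contra! hne
  refine h.not_ge ?_
  -- If no root `ζ` worked, every linear factor of `q(y)` would have value at least `1`.
  rw [(IsAlgClosed.splits q).eq_prod_roots_of_monic hq, map_multiset_prod, map_multiset_prod,
    Multiset.map_map, Multiset.map_map]
  refine Multiset.one_le_prod_of_one_le fun x hx => ?_
  obtain ⟨ζ, -, rfl⟩ := Multiset.mem_map.mp hx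
  simpa using hne ζ

/-- The first Bezout coefficient is reduced modulo `e` to make it a natural number, since it becomes
the exponent `a` in `s ^ e = y ^ a π`. -/
theorem Int.exists_gcd_factor_bezout (n : ℤ) {N : ℕ} (hN : N ≠ 0) :
    ∃ (g e : ℕ) (m b : ℤ) (a : ℕ), N = e * g ∧ n = m * g ∧ e ≠ 0 ∧ a * m + b * e = 1 := by
  have hg : 0 < Int.gcd n N := Int.gcd_pos_of_ne_zero_right _ (by exact_mod_cast hN)
  obtain ⟨m, e', h1, h2, h3⟩ := Int.exists_gcd_one hg
  have he' : 0 < e' := by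
    by_contra! h
    have h4 : (N : ℤ) ≤ 0 := by
      rw [h3]
      exact mul_nonpos_of_nonpos_of_nonneg h (Int.natCast_nonneg _)
    omega
  lift e' to ℕ using he'.le
  obtain ⟨u, v, huv⟩ := Int.isCoprime_iff_gcd_eq_one.mpr h1
  have ha : 0 ≤ u % e' := Int.emod_nonneg _ he'.ne'
  refine ⟨Int.gcd n N, e', m, v + u / e' * m, (u % e').toNat, by exact_mod_cast h3, h2,
    by omega, ?_⟩
  rw [Int.toNat_of_nonneg ha]
  have := Int.emod_add_mul_ediv u e'
  linear_combination huv + m * this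

open Polynomial in
/-- The tame chart at a place of a Kummer extension, where `z ^ N = π ^ n * (unit)`. -/
theorem CurvePlace.exists_tameChart {k L : Type u} [Field k] [Field L] [Algebra k L]
    [IsAlgClosed k] (B : CurvePlace k L) {π z : L} (hπ0 : π ≠ 0) (hπ : B.ring.valuation π < 1)
    {N g e a : ℕ} {n m b : ℤ} {h₁ h₂ : k[X]} (hN0 : (N : k) ≠ 0)
    (he1 : h₁.eval 0 ≠ 0) (he2 : h₂.eval 0 ≠ 0)
    (hz : z ^ N = π ^ n * (aeval π h₁ / aeval π h₂))
    (hgen : IntermediateField.adjoin k {π, z} = ⊤)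
    (hN : N = e * g) (hn : n = m * g) (hab : a * m + b * e = 1) :
    ∃ ζ : k, TameChart B π (z ^ e * π ^ (-m)) (z ^ a * π ^ b) ζ a g e h₁ h₂ := by
  have hπ' : B.ring.valuation (π - algebraMap k L 0) < 1 := by simpa using hπ
  have hv1 := B.valuation_aeval_eq_one hπ' he1
  have hv2 := B.valuation_aeval_eq_one hπ' he2
  have h10 : aeval π h₁ ≠ 0 := fun h => by simp [h] at hv1
  have h20 : aeval π h₂ ≠ 0 := fun h => by simp [h] at hv2
  have hNne : N ≠ 0 := fun h => hN0 (by rw [h, Nat.cast_zero])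
  have hz0 : z ≠ 0 := by
    rintro rfl
    rw [zero_pow hNne] at hz
    exact mul_ne_zero (zpow_ne_zero _ hπ0) (div_ne_zero h10 h20) hz.symm
  have hgk : (g : k) ≠ 0 := fun h => hN0 (by rw [hN, Nat.cast_mul, h, mul_zero])
  have hek : (e : k) ≠ 0 := fun h => hN0 (by rw [hN, Nat.cast_mul, h, zero_mul])
  have hg0 : g ≠ 0 := fun h => hgk (by rw [h, Nat.cast_zero])
  -- `y ^ g = z ^ N π ^ (-n)` is the unit part, and `s = z ^ a π ^ b` satisfies `s ^ e = y ^ a π ^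
  -- (a m + b e) = y ^ a π`.
  set y := z ^ e * π ^ (-m) with hy
  have hyg : y ^ g = aeval π h₁ / aeval π h₂ := by
    rw [hy, mul_pow, ← pow_mul, ← hN, hz, ← zpow_natCast (π ^ (-m)), ← zpow_mul, hn, neg_mul,
      mul_right_comm, ← zpow_add₀ hπ0, add_neg_cancel, zpow_zero, one_mul]
  set c := h₁.eval 0 / h₂.eval 0 with hc
  have hroot : B.ring.valuation (aeval y (X ^ g - C c)) < 1 := by
    have h3 := B.valuation_aeval_sub_lt hπ' (h₁ - C c * h₂)
    have h4 : (h₁ - C c * h₂).eval 0 = 0 := by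
      rw [eval_sub, eval_mul, eval_C, hc, div_mul_cancel₀ _ he2, sub_self]
    have h5 : aeval y (X ^ g - C c) = (aeval π (h₁ - C c * h₂) -
        algebraMap k L ((h₁ - C c * h₂).eval 0)) / aeval π h₂ := by
      rw [h4]
      simp only [map_sub, map_pow, map_mul, aeval_X, aeval_C, hyg, map_zero]
      field_simp
      ring
    rwa [h5, map_div₀, hv2, div_one]
  obtain ⟨ζ, hζ⟩ := B.exists_root_valuation_sub_lt_one (monic_X_pow_sub_C c hg0) hroot
  have hvy : B.ring.valuation y = 1 := by
    have h := congrArg B.ring.valuation hyg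
    rw [map_pow, map_div₀, hv1, hv2, div_one] at h
    exact (pow_eq_one_iff_of_nonneg zero_le hg0).mp h
  refine ⟨ζ, hπ0, hπ, ?_, hζ, hyg, he2, ?_, hgk, hek, ?_⟩
  · rintro rfl
    rw [map_zero, sub_zero] at hζ
    exact hζ.ne hvy
  · simp only [hy, ← zpow_natCast, mul_zpow, ← zpow_mul]
    rw [mul_comm (a : ℤ) (e : ℤ), mul_assoc, ← zpow_add_one₀ hπ0]
    congr 2
    linear_combination hab
  · rw [eq_top_iff, ← hgen, IntermediateField.adjoin_le_iff]
    set F := IntermediateField.adjoin k {π, y, z ^ a * π ^ b}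
    have m1 : π ∈ F := IntermediateField.subset_adjoin _ _ (by simp)
    have m2 : y ∈ F := IntermediateField.subset_adjoin _ _ (by simp)
    have m3 : z ^ a * π ^ b ∈ F := IntermediateField.subset_adjoin _ _ (by simp)
    rintro x (rfl | rfl)
    · exact m1
    -- Here `x` is `z`, recovered as `s ^ m y ^ b`.
    · have : x = (x ^ a * π ^ b) ^ m * y ^ b := by
        simp only [hy, mul_zpow, ← zpow_natCast, ← zpow_mul]
        rw [mul_mul_mul_comm, ← zpow_add₀ hz0, ← zpow_add₀ hπ0]
        have e1 : (a : ℤ) * m + e * b = 1 := by linear_combination hab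
        have e2 : b * m + -m * b = 0 := by ring
        rw [e1, e2, zpow_one, zpow_zero, mul_one]
      rw [this]
      exact F.mul_mem (zpow_mem m3 _) (zpow_mem m2 _)

open Polynomial in
/-- The value of `σ` at a point of a `μ_{p-1}`-cover. -/
theorem CurvePlace.ord_add_one_div_stabilizerCard {p : ℕ} (hp : p.Prime) {k K L : Type u} [Field k]
    [Field K] [Field L] [Algebra k K] [Algebra k L] [Algebra K L] [IsScalarTower k K L]
    [IsAlgClosed k] [CharP k p] (B : CurvePlace k L) {π z : L} (hπ0 : π ≠ 0)
    (hπ : B.ring.valuation π < 1) {n l : ℤ} {h₁ h₂ h₃ h₄ : k[X]} (he1 : h₁.eval 0 ≠ 0)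
    (he2 : h₂.eval 0 ≠ 0) (he3 : h₃.eval 0 ≠ 0) (he4 : h₄.eval 0 ≠ 0)
    (hz : z ^ (p - 1) = π ^ n * (aeval π h₁ / aeval π h₂))
    (hgen : IntermediateField.adjoin k {π, z} = ⊤) {ω : Ω[L⁄k]} (hω0 : ω ≠ 0)
    (hω : ω = (π ^ l * (aeval π h₃ / aeval π h₄) * z) • KaehlerDifferential.D k L π)
    (χ : (L ≃ₐ[K] L) ≃* (ZMod p)ˣ) (hτπ : ∀ τ : L ≃ₐ[K] L, τ π = π)
    (hτz : ∀ τ : L ≃ₐ[K] L, τ z = algebraMap k L ((χ τ : ZMod p).cast) * z) :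
    ((B.ord ω + 1 : ℤ) : ℚ) / (B.stabilizerCard K : ℚ) = l + 1 + n / ((p : ℚ) - 1) := by
  have := Fact.mk hp
  have hp1 : p - 1 ≠ 0 := by have := hp.two_le; omega
  have hcast : ((p - 1 : ℕ) : k) = -1 := by
    rw [Nat.cast_sub hp.one_le, CharP.cast_eq_zero, Nat.cast_one, zero_sub]
  have hp1k : ((p - 1 : ℕ) : k) ≠ 0 := by
    rw [hcast]
    exact neg_ne_zero.mpr one_ne_zero
  obtain ⟨g, e, m, b, a, hN, hn, he0, hab⟩ := Int.exists_gcd_factor_bezout n hp1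
  obtain ⟨ζ, H⟩ := B.exists_tameChart hπ0 hπ hp1k he1 he2 hz hgen hN hn hab
  have hg0 : g ≠ 0 := H.d_pos
  set y := z ^ e * π ^ (-m) with hy
  set s := z ^ a * π ^ b with hs
  have hz0 : z ≠ 0 := by
    rintro rfl
    exact H.y_ne_zero (by rw [hy, zero_pow he0, zero_mul])
  -- In the chart `π ^ l z = y ^ (b - a l) s ^ (e l + m)`, and `dπ` contributes `e - 1`.
  have hord : B.ord ω = e * l + m + e - 1 := by
    have hπ' : B.ring.valuation (π - algebraMap k L 0) < 1 := by simpa using hπ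
    refine H.ord_smul_D_π hω0 (g := y ^ (b - a * l) * (aeval π h₃ / aeval π h₄)) ?_ ?_
    · rw [map_mul, map_div₀, B.valuation_aeval_eq_one hπ' he3, B.valuation_aeval_eq_one hπ' he4,
        map_zpow₀, H.valuation_y, one_zpow, div_one, one_mul]
    · rw [hω]
      congr 1
      have hys : y ^ (b - a * l) * s ^ (e * l + m) = π ^ l * z := by
        simp only [hy, hs, mul_zpow, ← zpow_natCast, ← zpow_mul]
        rw [mul_mul_mul_comm, ← zpow_add₀ hz0, ← zpow_add₀ hπ0]
        have e1 : (e : ℤ) * (b - a * l) + a * (e * l + m) = 1 := by linear_combination hab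
        have e2 : -m * (b - a * l) + b * (e * l + m) = l := by linear_combination l * hab
        rw [e1, e2, zpow_one, mul_comm]
      linear_combination -(aeval π h₃ / aeval π h₄) * hys
  have hdec : ∀ τ : L ≃ₐ[K] L, τ ∈ B.ring.decompositionSubgroup K ↔ χ τ ^ e = 1 := by
    intro τ
    have hc0 : ((χ τ : ZMod p).cast : k) ≠ 0 := by
      have : ((χ τ : ZMod p).cast : k) = ZMod.castHom dvd_rfl k (χ τ : ZMod p) := rfl
      rw [this, _root_.map_ne_zero]
      exact (χ τ).ne_zero
    rw [H.mem_decompositionSubgroup_iff (K := K) (τ := τ) (hτπ τ)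
      (η := ((χ τ : ZMod p).cast : k) ^ e) (η' := ((χ τ : ZMod p).cast : k) ^ a)
      (pow_ne_zero _ hc0) ?_ ?_]
    · have : ((χ τ : ZMod p).cast : k) = ZMod.castHom dvd_rfl k (χ τ : ZMod p) := rfl
      rw [this, ← map_pow, map_eq_one_iff _ (ZMod.castHom dvd_rfl k).injective, ← Units.val_pow_eq_pow_val,
        Units.val_eq_one]
    · rw [hy, map_mul, map_pow, map_zpow₀, hτπ, hτz, map_pow]
      ring
    · rw [hs, map_mul, map_pow, map_zpow₀, hτπ, hτz, map_pow]
      ring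
  -- `τ` multiplies `y` by `χ(τ) ^ e`, so the stabilizer is the `e`-torsion of a cyclic group of
  -- order `p - 1 = e g`. The quotient is then `l + 1 + m / e`, with `m / e = n / (p - 1)`.
  have hcard : B.stabilizerCard K = e := by
    have h1 : Nat.card (powMonoidHom e : (ZMod p)ˣ →* (ZMod p)ˣ).ker = e := by
      rw [IsCyclic.card_powMonoidHom_ker, Nat.card_eq_fintype_card, ZMod.card_units, hN,
        Nat.gcd_mul_right_left]
    refine Eq.trans (Nat.card_congr (χ.toEquiv.subtypeEquiv fun τ => ?_)) h1
    exact hdec τ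
  have hpq : (p : ℚ) - 1 = e * g := by
    have := congrArg (Nat.cast : ℕ → ℚ) hN
    rwa [Nat.cast_sub hp.one_le, Nat.cast_mul, Nat.cast_one] at this
  have heq : (e : ℚ) ≠ 0 := by exact_mod_cast he0
  have hgq : (g : ℚ) ≠ 0 := by exact_mod_cast hg0
  rw [hord, hcard, hpq, hn]
  push_cast
  field_simp
  ring

/-! ### Places of `k(t)`. -/

namespace CurvePlace

theorem valuation_lt_one_iff_inv_notMem {k L : Type u} [Field k] [Field L] [Algebra k L]
    (B : CurvePlace k L) {x : L} (hx : x ≠ 0) : B.ring.valuation x < 1 ↔ x⁻¹ ∉ B.ring := by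
  have h0 : 0 < B.ring.valuation x := zero_lt_iff.mpr (by simpa using hx)
  rw [← B.ring.valuation_le_one_iff, map_inv₀, inv_le_one₀ h0, not_le]

theorem LiesAbove.valuation_lt_one_iff {k K L : Type u} [Field k] [Field K] [Field L] [Algebra k K]
    [Algebra k L] [Algebra K L] {z : CurvePlace k L} {x : CurvePlace k K} (h : z.LiesAbove x)
    {b : K} (hb : b ≠ 0) :
    z.ring.valuation (algebraMap K L b) < 1 ↔ x.ring.valuation b < 1 := by
  rw [z.valuation_lt_one_iff_inv_notMem (by simpa using hb), x.valuation_lt_one_iff_inv_notMem hb,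
    ← map_inv₀, ← h]
  rfl

open Polynomial in
theorem exists_eq_zpow_mul_aeval_div {k K : Type u} [Field k] [Field K] [Algebra k K] {π : K}
    (hπ0 : π ≠ 0) (hgen : IntermediateField.adjoin k {π} = ⊤) {b : K} (hb : b ≠ 0) :
    ∃ (m : ℤ) (h₁ h₂ : k[X]), h₁.eval 0 ≠ 0 ∧ h₂.eval 0 ≠ 0 ∧
      b = π ^ m * (aeval π h₁ / aeval π h₂) := by
  have hmem : b ∈ IntermediateField.adjoin k {π} := by
    rw [hgen]; exact IntermediateField.mem_top
  obtain ⟨r, r', rfl⟩ := (IntermediateField.mem_adjoin_simple_iff k b).mp hmem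
  have hpoly : ∀ q : k[X], q ≠ 0 → ∃ (m : ℕ) (q' : k[X]), q'.eval 0 ≠ 0 ∧ q = X ^ m * q' := by
    intro q hq
    obtain ⟨q', h1, h2⟩ := exists_eq_pow_rootMultiplicity_mul_and_not_dvd q hq 0
    refine ⟨q.rootMultiplicity 0, q', fun h => h2 (dvd_iff_isRoot.mpr h), ?_⟩
    rw [C_0, sub_zero] at h1
    exact h1
  have hr : r ≠ 0 := by rintro rfl; simp at hb
  have hr' : r' ≠ 0 := by rintro rfl; simp at hb
  obtain ⟨m, q, hq, rfl⟩ := hpoly r hr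
  obtain ⟨m', q', hq', rfl⟩ := hpoly r' hr'
  refine ⟨m - m', q, q', hq, hq', ?_⟩
  rw [map_mul, map_mul, map_pow, map_pow, aeval_X, zpow_sub₀ hπ0, zpow_natCast, zpow_natCast,
    mul_div_mul_comm]

open Polynomial in
theorem valuation_zpow_mul_aeval_div {k K : Type u} [Field k] [Field K] [Algebra k K]
    (x : CurvePlace k K) {π : K} (hx : x.ring.valuation π < 1) (m : ℤ) {h₁ h₂ : k[X]}
    (e1 : h₁.eval 0 ≠ 0) (e2 : h₂.eval 0 ≠ 0) :
    x.ring.valuation (π ^ m * (aeval π h₁ / aeval π h₂)) = x.ring.valuation π ^ m := by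
  have hx0 : x.ring.valuation (π - algebraMap k K 0) < 1 := by simpa using hx
  rw [map_mul, map_div₀, x.valuation_aeval_eq_one hx0 e1, x.valuation_aeval_eq_one hx0 e2, div_one,
    mul_one, map_zpow₀]

open Polynomial in
/-- If the `h`-th power of an element of order `n` is an `N`-th power, then `N` divides `n * h`. -/
theorem dvd_mul_of_pow_eq_pow {k K : Type u} [Field k] [Field K] [Algebra k K]
    (x : CurvePlace k K) {π : K} (hπ0 : π ≠ 0) (hgen : IntermediateField.adjoin k {π} = ⊤)
    (hx : x.ring.valuation π < 1) {n : ℤ} {h₁ h₂ : k[X]}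
    (e1 : h₁.eval 0 ≠ 0) (e2 : h₂.eval 0 ≠ 0) {h N : ℕ} {g : K} (hg : g ≠ 0)
    (hfg : (π ^ n * (aeval π h₁ / aeval π h₂)) ^ h = g ^ N) : (N : ℤ) ∣ n * h := by
  obtain ⟨m, h₃, h₄, e3, e4, rfl⟩ := exists_eq_zpow_mul_aeval_div hπ0 hgen hg
  have h0 : 0 < x.ring.valuation π := zero_lt_iff.mpr (by simpa using hπ0)
  have h5 := congrArg x.ring.valuation hfg
  rw [map_pow, map_pow, x.valuation_zpow_mul_aeval_div hx n e1 e2,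
    x.valuation_zpow_mul_aeval_div hx m e3 e4, ← zpow_natCast, ← zpow_natCast, ← zpow_mul,
    ← zpow_mul] at h5
  exact ⟨m, by rw [zpow_right_injective₀ h0 hx.ne h5, mul_comm]⟩

open Polynomial in
/-- Two places of `k(π)` at which `π` vanishes are equal. -/
theorem eq_of_valuation_lt_one {k K : Type u} [Field k] [Field K] [Algebra k K] {π : K}
    (hπ0 : π ≠ 0) (hgen : IntermediateField.adjoin k {π} = ⊤) {x x' : CurvePlace k K}
    (hx : x.ring.valuation π < 1) (hx' : x'.ring.valuation π < 1) : x = x' := by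
  have hval : ∀ (x : CurvePlace k K), x.ring.valuation π < 1 → ∀ (m : ℤ) (h₁ h₂ : k[X]),
      h₁.eval 0 ≠ 0 → h₂.eval 0 ≠ 0 →
      (π ^ m * (aeval π h₁ / aeval π h₂) ∈ x.ring ↔ 0 ≤ m) := by
    intro x hx m h₁ h₂ e1 e2
    have h0 : 0 < x.ring.valuation π := zero_lt_iff.mpr (by simpa using hπ0)
    rw [← x.ring.valuation_le_one_iff, x.valuation_zpow_mul_aeval_div hx m e1 e2,
      zpow_le_one_iff_right_of_lt_one₀ h0 hx]
  ext b
  by_cases hb : b = 0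
  · simp [hb, zero_mem]
  obtain ⟨m, h₁, h₂, e1, e2, rfl⟩ := exists_eq_zpow_mul_aeval_div hπ0 hgen hb
  rw [hval x hx m h₁ h₂ e1 e2, hval x' hx' m h₁ h₂ e1 e2]

end CurvePlace

namespace ProjectiveLine

variable {k : Type u} [Field k]

theorem X_sub_C_ne_zero (a : k) : (RatFunc.X - RatFunc.C a : RatFunc k) ≠ 0 := by
  have := RatFunc.algebraMap_ne_zero (Polynomial.X_sub_C_ne_zero a)
  rwa [map_sub, RatFunc.algebraMap_X, RatFunc.algebraMap_C] at this

theorem adjoin_X_sub_C_eq_top (a : k) :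
    IntermediateField.adjoin k {(RatFunc.X - RatFunc.C a : RatFunc k)} = ⊤ := by
  rw [eq_top_iff, ← RatFunc.adjoin_X, IntermediateField.adjoin_simple_le_iff]
  have h1 := IntermediateField.mem_adjoin_simple_self k (RatFunc.X - RatFunc.C a : RatFunc k)
  have h2 := (IntermediateField.adjoin k {(RatFunc.X - RatFunc.C a : RatFunc k)}).algebraMap_mem a
  have := add_mem h1 h2
  rwa [RatFunc.algebraMap_eq_C, sub_add_cancel] at this

theorem adjoin_inv_X_eq_top :
    IntermediateField.adjoin k {(RatFunc.X⁻¹ : RatFunc k)} = ⊤ := by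
  rw [eq_top_iff, ← RatFunc.adjoin_X, IntermediateField.adjoin_simple_le_iff]
  have := inv_mem (IntermediateField.mem_adjoin_simple_self k (RatFunc.X⁻¹ : RatFunc k))
  rwa [inv_inv] at this

theorem valuation_finitePlace_X_sub_C (a : k) :
    (finitePlace a).ring.valuation (RatFunc.X - RatFunc.C a) < 1 := by
  rw [CurvePlace.valuation_lt_one_iff_inv_notMem _ (X_sub_C_ne_zero a)]
  have h0 := X_sub_C_ne_zero a
  have h : (pointIdeal a).valuation (RatFunc k) (RatFunc.X - RatFunc.C a) < 1 := by
    have e : algebraMap (Polynomial k) (RatFunc k) (Polynomial.X - Polynomial.C a) =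
        RatFunc.X - RatFunc.C a := by
      rw [map_sub, RatFunc.algebraMap_X, RatFunc.algebraMap_C]
    rw [← e]
    exact ((pointIdeal a).valuation_lt_one_iff_mem _).mpr (Ideal.mem_span_singleton_self _)
  change ¬ _ ∈ ((pointIdeal a).valuation (RatFunc k)).valuationSubring
  rw [Valuation.mem_valuationSubring_iff, map_inv₀, not_le]
  exact (one_lt_inv₀ (zero_lt_iff.mpr (by simpa using h0))).mpr h

theorem valuation_inftyPlace_inv_X : (inftyPlace k).ring.valuation (RatFunc.X⁻¹) < 1 := by
  classical
  rw [CurvePlace.valuation_lt_one_iff_inv_notMem _ (inv_ne_zero RatFunc.X_ne_zero), inv_inv]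
  change ¬ _ ∈ (RatFunc.inftyValuation k).valuationSubring
  intro h1
  rw [Valuation.mem_valuationSubring_iff, RatFunc.inftyValuation.X, ← WithZero.exp_zero,
    WithZero.exp_le_exp] at h1
  omega

/-- Every place of `k(t)` is a point of the projective line. -/
theorem eq_finitePlace_or_eq_inftyPlace [IsAlgClosed k] (x : CurvePlace k (RatFunc k)) :
    (∃ a, x = finitePlace a) ∨ x = inftyPlace k := by
  by_cases hX : RatFunc.X ∈ x.ring
  · left
    by_cases h : ∃ a : k, x.ring.valuation (RatFunc.X - RatFunc.C a) < 1
    · obtain ⟨a, ha⟩ := h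
      exact ⟨a, CurvePlace.eq_of_valuation_lt_one (X_sub_C_ne_zero a) (adjoin_X_sub_C_eq_top a) ha
        (valuation_finitePlace_X_sub_C a)⟩
    exfalso
    refine x.ne_top (eq_top_iff.mpr fun b _ => ?_)
    -- If no `t - a` vanishes at the place, every nonzero polynomial in `t` is a unit there, and the
    -- valuation ring would be all of `k(t)`.
    have hunit : ∀ q : Polynomial k, q ≠ 0 →
        x.ring.valuation (Polynomial.aeval (RatFunc.X : RatFunc k) q) = 1 := by
      intro q hq
      refine le_antisymm (x.valuation_aeval_le ((x.ring.valuation_le_one_iff _).mpr hX) q) ?_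
      by_contra! hlt
      have hm := Polynomial.monic_mul_leadingCoeff_inv hq
      have : x.ring.valuation (Polynomial.aeval (RatFunc.X : RatFunc k)
          (q * Polynomial.C q.leadingCoeff⁻¹)) < 1 := by
        rw [map_mul, map_mul, Polynomial.aeval_C]
        exact mul_lt_one_of_lt_of_le hlt (x.valuation_algebraMap_le _)
      obtain ⟨ζ, hζ⟩ := x.exists_root_valuation_sub_lt_one hm this
      exact h ⟨ζ, hζ⟩
    have hmem : b ∈ IntermediateField.adjoin k {(RatFunc.X : RatFunc k)} := by
      rw [RatFunc.adjoin_X]; exact IntermediateField.mem_top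
    obtain ⟨r, r', rfl⟩ := (IntermediateField.mem_adjoin_simple_iff k b).mp hmem
    rw [← x.ring.valuation_le_one_iff, map_div₀]
    by_cases hr' : r' = 0
    · simp [hr']
    rw [hunit r' hr', div_one]
    exact x.valuation_aeval_le ((x.ring.valuation_le_one_iff _).mpr hX) r
  · right
    refine CurvePlace.eq_of_valuation_lt_one (inv_ne_zero RatFunc.X_ne_zero) adjoin_inv_X_eq_top ?_
      valuation_inftyPlace_inv_X
    rwa [CurvePlace.valuation_lt_one_iff_inv_notMem _ (inv_ne_zero RatFunc.X_ne_zero), inv_inv]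

theorem finitePlace_injective : Function.Injective (finitePlace : k → _) := by
  intro a b h
  have h1 := valuation_finitePlace_X_sub_C a
  have h2 := valuation_finitePlace_X_sub_C b
  rw [← h] at h2
  have h3 := (finitePlace a).ring.valuation.map_sub_lt h1 h2
  have h4 : (RatFunc.X - RatFunc.C a - (RatFunc.X - RatFunc.C b) : RatFunc k) =
      algebraMap k (RatFunc k) (b - a) := by
    rw [RatFunc.algebraMap_eq_C, map_sub]
    ring
  rw [h4] at h3
  exact (sub_eq_zero.mp ((finitePlace a).eq_zero_of_valuation_algebraMap_lt_one h3)).symm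

theorem finitePlace_ne_inftyPlace (a : k) : finitePlace a ≠ inftyPlace k := by
  intro h
  have h1 := valuation_finitePlace_X_sub_C a
  have h2 := valuation_inftyPlace_inv_X (k := k)
  rw [← h] at h2
  rw [CurvePlace.valuation_lt_one_iff_inv_notMem _ (inv_ne_zero RatFunc.X_ne_zero), inv_inv] at h2
  refine h2 ?_
  have h3 := (finitePlace a).ring.add_mem _ _ (((finitePlace a).ring.valuation_le_one_iff _).mp h1.le)
    ((finitePlace a).algebraMap_mem a)
  rwa [RatFunc.algebraMap_eq_C, sub_add_cancel] at h3

end ProjectiveLine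

/-! ### The derivation `d/dt` and Kummer theory. -/

/-- On a finite separable extension of `k(t)` there is a derivation `D = d / dt`, and `dx = D x dt`
for every `x`. -/
theorem exists_derivation_of_ratFunc (k L : Type u) [Field k] [Field L] [Algebra k L]
    [Algebra (RatFunc k) L] [IsScalarTower k (RatFunc k) L] [Algebra.IsSeparable (RatFunc k) L] :
    ∃ D : Derivation k L L, D (algebraMap (RatFunc k) L RatFunc.X) = 1 ∧
      KaehlerDifferential.D k L (algebraMap (RatFunc k) L RatFunc.X) ≠ 0 ∧
      ∀ x, KaehlerDifferential.D k L x =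
        D x • KaehlerDifferential.D k L (algebraMap (RatFunc k) L RatFunc.X) := by
  let : Algebra (Polynomial k) L := Algebra.compHom L (algebraMap (Polynomial k) (RatFunc k))
  have : IsScalarTower (Polynomial k) (RatFunc k) L := IsScalarTower.of_algebraMap_eq fun _ => rfl
  have : IsScalarTower k (Polynomial k) L := IsScalarTower.of_algebraMap_eq fun c => by
    rw [IsScalarTower.algebraMap_apply (Polynomial k) (RatFunc k) L,
      ← IsScalarTower.algebraMap_apply k (Polynomial k) (RatFunc k),
      ← IsScalarTower.algebraMap_apply k (RatFunc k) L]
  -- Localizations and separable extensions are formally étale, so the differentials of `L` are the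
  -- base change of those of `k[X]`, which are free on `dX`.
  have : Algebra.FormallyEtale (Polynomial k) (RatFunc k) :=
    Algebra.FormallyEtale.of_isLocalization (nonZeroDivisors (Polynomial k))
  have : Algebra.FormallyEtale (RatFunc k) L := Algebra.FormallyEtale.of_isSeparable _ _
  have : Algebra.FormallyEtale (Polynomial k) L :=
    Algebra.FormallyEtale.comp (Polynomial k) (RatFunc k) L
  let e : Ω[L⁄k] ≃ₗ[L] L :=
    (KaehlerDifferential.tensorKaehlerEquivOfFormallyEtale k (Polynomial k) L).symm ≪≫ₗ
      (KaehlerDifferential.polynomialEquiv k).baseChange (Polynomial k) L _ _ ≪≫ₗ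
      TensorProduct.AlgebraTensorModule.rid (Polynomial k) L L
  have hX : algebraMap (RatFunc k) L RatFunc.X = algebraMap (Polynomial k) L Polynomial.X := by
    rw [IsScalarTower.algebraMap_apply (Polynomial k) (RatFunc k) L, RatFunc.algebraMap_X]
  have he : e (KaehlerDifferential.D k L (algebraMap (RatFunc k) L RatFunc.X)) = 1 := by
    rw [hX]
    simp only [e, LinearEquiv.trans_apply,
      KaehlerDifferential.tensorKaehlerEquivOfFormallyEtale_symm_D_algebraMap,
      LinearEquiv.baseChange_tmul, KaehlerDifferential.polynomialEquiv_D,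
      Polynomial.derivative_X, TensorProduct.AlgebraTensorModule.rid_tmul, one_smul]
  refine ⟨e.toLinearMap.compDer (KaehlerDifferential.D k L), he, ?_, fun x => ?_⟩
  · intro h
    rw [h, map_zero] at he
    exact zero_ne_one he
  · apply e.injective
    rw [map_smul, he, smul_eq_mul, mul_one]
    rfl

section Kummer

open Polynomial

variable {p : ℕ} {K : Type u} [Field K]

/-- The equation gives `x ^ p = x`, and the elements fixed by Frobenius form the prime field. -/
theorem exists_zmod_unit_of_pow_eq_one (hp : p.Prime) {L : Type u} [Field L] [CharP L p] {x : L}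
    (hx : x ^ (p - 1) = 1) : ∃ c : (ZMod p)ˣ, ZMod.castHom dvd_rfl L (c : ZMod p) = x := by
  have := Fact.mk hp
  have h1 : x ∈ (⊥ : Subfield L) := by
    rw [Subfield.mem_bot_iff_pow_eq_self L p]
    rw [← Nat.sub_add_cancel hp.one_le, pow_succ, hx, one_mul]
  have h2 : x ∈ (ZMod.castHom dvd_rfl L : ZMod p →+* L).fieldRange :=
    (bot_le : (⊥ : Subfield L) ≤ _) h1
  obtain ⟨c, rfl⟩ := h2
  refine ⟨Units.mk0 c ?_, rfl⟩
  rintro rfl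
  have := hp.two_le
  rw [map_zero, zero_pow (by omega)] at hx
  exact zero_ne_one hx

/-- Kummer theory for `z ^ (p - 1) = f` in characteristic `p`. -/
theorem exists_kummer_generator (hp : p.Prime) [CharP K p] {f : K} (hf0 : f ≠ 0)
    (hf : ∀ (h : ℕ) (g : K), f ^ h = g ^ (p - 1) → p - 1 ∣ h)
    (L : Type u) [Field L] [Algebra K L] [IsSplittingField K L (X ^ (p - 1) - C f : K[X])] :
    IsGalois K L ∧ ∃ (z : L) (χ : (L ≃ₐ[K] L) ≃* (ZMod p)ˣ), z ^ (p - 1) = algebraMap K L f ∧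
      IntermediateField.adjoin K {z} = ⊤ ∧
      ∀ τ : L ≃ₐ[K] L, τ z = algebraMap K L (ZMod.castHom dvd_rfl K (χ τ : ZMod p)) * z := by
  have := Fact.mk hp
  have hN : p - 1 ≠ 0 := by have := hp.two_le; omega
  have : CharP L p := charP_of_injective_algebraMap (algebraMap K L).injective p
  have hNK : ((p - 1 : ℕ) : K) ≠ 0 := by
    rw [Nat.cast_sub hp.one_le, CharP.cast_eq_zero, Nat.cast_one, zero_sub]
    exact neg_ne_zero.mpr one_ne_zero
  have hgal : IsGalois K L :=
    IsGalois.of_separable_splitting_field (separable_X_pow_sub_C f hNK hf0)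
  have : FiniteDimensional K L := IsSplittingField.finiteDimensional L (X ^ (p - 1) - C f : K[X])
  obtain ⟨z, hz⟩ : ∃ z : L, z ^ (p - 1) = algebraMap K L f := by
    obtain ⟨z, hz⟩ := Splits.exists_eval_eq_zero
      (IsSplittingField.splits L (X ^ (p - 1) - C f : K[X])) (by
        rw [degree_map, degree_X_pow_sub_C (Nat.pos_of_ne_zero hN)]
        exact_mod_cast hN)
    refine ⟨z, ?_⟩
    simpa [sub_eq_zero] using hz
  have hz0 : z ≠ 0 := by
    rintro rfl
    rw [zero_pow hN] at hz
    exact hf0 ((map_eq_zero _).mp hz.symm)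
  have hroot : ∀ w : L, w ^ (p - 1) = algebraMap K L f → ∃ c : (ZMod p)ˣ,
      w = algebraMap K L (ZMod.castHom dvd_rfl K (c : ZMod p)) * z := by
    intro w hw
    obtain ⟨c, hc⟩ := exists_zmod_unit_of_pow_eq_one hp (x := w / z) (by
      rw [div_pow, hw, hz, div_self]
      rwa [ne_eq, map_eq_zero])
    refine ⟨c, ?_⟩
    have h : algebraMap K L (ZMod.castHom dvd_rfl K (c : ZMod p)) =
        ZMod.castHom dvd_rfl L (c : ZMod p) :=
      congrArg (fun φ : ZMod p →+* L => φ (c : ZMod p)) (Subsingleton.elim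
        ((algebraMap K L).comp (ZMod.castHom dvd_rfl K)) (ZMod.castHom dvd_rfl L))
    rw [h, hc, div_mul_cancel₀ _ hz0]
  have hgen : IntermediateField.adjoin K {z} = ⊤ := by
    have hle : Algebra.adjoin K ((X ^ (p - 1) - C f : K[X]).rootSet L) ≤
        (IntermediateField.adjoin K {z}).toSubalgebra := by
      refine Algebra.adjoin_le fun w hw => ?_
      have hw0 : w ^ (p - 1) = algebraMap K L f := by
        simpa [sub_eq_zero] using (mem_rootSet.mp hw).2
      obtain ⟨c, rfl⟩ := hroot w hw0
      exact mul_mem ((IntermediateField.adjoin K {z}).algebraMap_mem _)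
        (IntermediateField.mem_adjoin_simple_self K z)
    rw [IsSplittingField.adjoin_rootSet] at hle
    exact eq_top_iff.mpr fun x _ => hle Algebra.mem_top
  have hτ : ∀ τ : L ≃ₐ[K] L, ∃ c : (ZMod p)ˣ,
      τ z = algebraMap K L (ZMod.castHom dvd_rfl K (c : ZMod p)) * z := fun τ =>
    hroot _ (by rw [← map_pow, hz, τ.commutes])
  choose χ hχ using hτ
  have hinj : ∀ c c' : (ZMod p)ˣ, algebraMap K L (ZMod.castHom dvd_rfl K (c : ZMod p)) * z =
      algebraMap K L (ZMod.castHom dvd_rfl K (c' : ZMod p)) * z → c = c' := fun c c' h =>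
    Units.ext ((ZMod.castHom dvd_rfl K).injective
      ((algebraMap K L).injective (mul_right_cancel₀ hz0 h)))
  let χh : (L ≃ₐ[K] L) →* (ZMod p)ˣ := MonoidHom.mk' χ fun τ τ' => by
    refine hinj _ _ ?_
    rw [← hχ, AlgEquiv.mul_apply, hχ τ', map_mul, τ.commutes, hχ τ, Units.val_mul, map_mul, map_mul]
    ring
  have hχinj : Function.Injective χh := by
    rw [injective_iff_map_eq_one]
    intro τ hτ1
    have h1 : τ z = z := by
      rw [hχ τ]
      have : χ τ = 1 := hτ1
      rw [this, Units.val_one, map_one, map_one, one_mul]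
    ext x
    have hx : x ∈ IntermediateField.adjoin K {z} := by
      rw [hgen]; exact IntermediateField.mem_top
    rw [AlgEquiv.one_apply]
    induction hx using IntermediateField.adjoin_induction with
    | mem x hx => rw [Set.mem_singleton_iff.mp hx, h1]
    | algebraMap c => exact τ.commutes c
    | add x y _ _ hx hy => rw [map_add, hx, hy]
    | mul x y _ _ hx hy => rw [map_mul, hx, hy]
    | inv x _ hx => rw [map_inv₀, hx]
  have hsurj : Function.Surjective χh := by
    have hle := Nat.card_le_card_of_injective χh hχinj
    rw [Nat.card_eq_fintype_card (α := (ZMod p)ˣ), ZMod.card_units] at hle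
    -- Let `H` be the Galois group. As `χ ^ |H| = 1`, the power `z ^ |H|` is fixed and lies in `K`.
    -- Then `f ^ |H|` is a `(p - 1)`-th power in `K`, and the hypothesis on `f` gives `p - 1 ∣ |H|`.
    have hfix : z ^ Nat.card (L ≃ₐ[K] L) ∈ (⊥ : IntermediateField K L) := by
      rw [IsGalois.mem_bot_iff_fixed]
      intro τ
      have h1 : χ τ ^ Nat.card (L ≃ₐ[K] L) = 1 := by
        change χh τ ^ _ = 1
        rw [← map_pow, pow_card_eq_one', map_one]
      rw [map_pow, hχ τ, mul_pow, ← map_pow, ← map_pow, ← Units.val_pow_eq_pow_val, h1,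
        Units.val_one, map_one, map_one, one_mul]
    obtain ⟨g, hg⟩ := IntermediateField.mem_bot.mp hfix
    have hdvd : p - 1 ∣ Nat.card (L ≃ₐ[K] L) := by
      refine hf _ g ((algebraMap K L).injective ?_)
      rw [map_pow, map_pow, hg, ← hz, ← pow_mul, ← pow_mul, mul_comm]
    have heq : Nat.card (L ≃ₐ[K] L) = Nat.card (ZMod p)ˣ := by
      rw [Nat.card_eq_fintype_card (α := (ZMod p)ˣ), ZMod.card_units]
      exact le_antisymm hle (Nat.le_of_dvd Nat.card_pos hdvd)
    exact ((Nat.bijective_iff_injective_and_card χh).mpr ⟨hχinj, heq⟩).2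
  exact ⟨hgal, z, MulEquiv.ofBijective χh ⟨hχinj, hsurj⟩, hz, hgen, hχ⟩

end Kummer

/-! ### The equation `D^(p-1) u = -u^p`. -/

section Logarithmic

open Polynomial

variable {k L : Type u} [Field k] [Field L] [Algebra k L] {p : ℕ} (D : Derivation k L L)

theorem Derivation.iterate_mul_of_eq_zero {c : L} (hc : D c = 0) (y : L) (n : ℕ) :
    D^[n] (c * y) = c * D^[n] y := by
  induction n generalizing y with
  | zero => rfl
  | succ n ih =>
    rw [Function.iterate_succ_apply, Function.iterate_succ_apply, ← ih, D.leibniz, hc, smul_zero,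
      add_zero, smul_eq_mul]

theorem Derivation.map_pow_char [CharP L p] (x : L) : D (x ^ p) = 0 := by
  rw [D.leibniz_pow, ← Nat.cast_smul_eq_nsmul L p, CharP.cast_eq_zero, zero_smul]

theorem Derivation.iterate_aeval {t : L} (ht : D t = 1) (q : k[X]) (n : ℕ) :
    D^[n] (aeval t q) = aeval t (derivative^[n] q) := by
  induction n generalizing q with
  | zero => rfl
  | succ n ih =>
    rw [Function.iterate_succ_apply, Function.iterate_succ_apply, D.map_aeval, ht, smul_eq_mul,
      mul_one, ih]

/-- The factor `x ^ p` is a constant for `D`, and a `p`-th derivative of a polynomial is divisible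
by `p!`. Rational functions of `t` take this form once the denominator is made a `p`-th power. -/
theorem Derivation.iterate_char_pow_mul_aeval (hp : p.Prime) [CharP k p] [CharP L p] {t : L}
    (ht : D t = 1) (q : k[X]) (x : L) : D^[p] (x ^ p * aeval t q) = 0 := by
  rw [D.iterate_mul_of_eq_zero (D.map_pow_char x), D.iterate_aeval ht,
    iterate_derivative_eq_factorial_smul_sum, ← Nat.cast_smul_eq_nsmul k,
    (CharP.cast_eq_zero_iff k p _).mpr (Nat.dvd_factorial hp.pos le_rfl), zero_smul, map_zero,
    mul_zero]

/-- Write `(t - a)⁻¹` as the constant `(t - a) ^ (-p)` times `(t - a) ^ (p - 1)`; the latter has `(p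
- 1)`-th derivative `(p - 1)! = -1` by Wilson's theorem. -/
theorem Derivation.iterate_pred_char_inv_sub (hp : p.Prime) [CharP k p] [CharP L p] {t : L}
    (ht : D t = 1) {a : k} (ha : t - algebraMap k L a ≠ 0) :
    D^[p - 1] (t - algebraMap k L a)⁻¹ = -((t - algebraMap k L a)⁻¹ ^ p) := by
  have h1 : (t - algebraMap k L a)⁻¹ =
      (t - algebraMap k L a)⁻¹ ^ p * aeval t ((X - C a) ^ (p - 1)) := by
    obtain ⟨q, hq⟩ : ∃ q, p = q + 1 := ⟨p - 1, (Nat.sub_add_cancel hp.one_le).symm⟩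
    rw [map_pow, map_sub, aeval_X, aeval_C, hq, Nat.add_sub_cancel, pow_succ', mul_assoc, ← mul_pow,
      inv_mul_cancel₀ ha, one_pow, mul_one]
  have := Fact.mk hp
  have h2 : (((p - 1).factorial : ℕ) : L) = -1 := by
    have := congrArg (ZMod.castHom dvd_rfl L) (ZMod.wilsons_lemma p)
    rwa [_root_.map_natCast, _root_.map_neg, _root_.map_one] at this
  conv_lhs => rw [h1]
  rw [D.iterate_mul_of_eq_zero (D.map_pow_char _), D.iterate_aeval ht,
    iterate_derivative_X_sub_pow_self, _root_.map_natCast, h2, mul_neg_one]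

/-- `D ^ (p - 1) u = - u ^ p` for `u = z / ((t - 1) (t - l))` where
`z ^ (p - 1) = ρ (l - 1) ^ (p - 1) t³ (t - b₁)² (t - b₂)²`. -/
theorem Derivation.iterate_pred_char_eq_neg_pow (hp : p.Prime) (hp2 : 2 < p) [CharP k p]
    [CharP L p] {t z : L} (ht : D t = 1) (htr : ∀ a : k, t - algebraMap k L a ≠ 0)
    {l b₁ b₂ ρ : k} {V : k[X]} (hl : l ≠ 1) (hρ : ρ ≠ 0)
    (hV : C ρ * X ^ 3 * ((X - C b₁) * (X - C b₂)) ^ 2 +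
      (X - C 1) * (X - C l) * (X * ((X - C b₁) * (X - C b₂)) * derivative V -
          V * (2 * ((X - C b₁) * (X - C b₂)) + X * (2 * X - C (b₁ + b₂)))) = 1)
    (hz : z ^ (p - 1) = aeval t
      (C (ρ * (l - 1) ^ (p - 1)) * X ^ 3 * ((X - C b₁) * (X - C b₂)) ^ 2)) :
    D^[p - 1] (z / aeval t ((X - C 1) * (X - C l))) =
      -(z / aeval t ((X - C 1) * (X - C l))) ^ p := by
  have hp1 : p - 1 + 1 = p := Nat.sub_add_cancel hp.one_le
  have h1 := htr 1
  have hl' := htr l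
  have hb1 := htr b₁
  have hb2 := htr b₂
  have ht0 : t ≠ 0 := by simpa using htr 0
  have hr : algebraMap k L ρ ≠ 0 := (_root_.map_ne_zero _).mpr hρ
  have hβ : algebraMap k L l - 1 ≠ 0 := by
    rw [← map_one (algebraMap k L), ← map_sub, _root_.map_ne_zero, sub_ne_zero]
    exact hl
  have hi1 := D.iterate_pred_char_inv_sub hp ht h1
  have hil := D.iterate_pred_char_inv_sub hp ht hl'
  have hV' := congrArg (aeval t) hV
  have hDρ : D (algebraMap k L ρ) = 0 := D.map_algebraMap ρ
  have hDl : D (algebraMap k L l - 1)⁻¹ = 0 := by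
    rw [← map_one (algebraMap k L), ← map_sub, ← map_inv₀, D.map_algebraMap]
  have hDc : D (z ^ p * (algebraMap k L ρ * (algebraMap k L l - 1) ^ (p - 1))⁻¹) = 0 := by
    rw [← map_one (algebraMap k L), ← map_sub, ← map_pow, ← map_mul, ← map_inv₀, D.leibniz,
      D.map_algebraMap, D.map_pow_char, smul_zero, smul_zero, add_zero]
  have hDv : D (aeval t V) = aeval t (derivative V) := by
    rw [D.map_aeval, ht, smul_eq_mul, mul_one]
  have hD1 : D (t ^ 2 * ((t - algebraMap k L b₁) * (t - algebraMap k L b₂))) =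
      2 * t * ((t - algebraMap k L b₁) * (t - algebraMap k L b₂)) +
        t ^ 2 * (2 * t - (algebraMap k L b₁ + algebraMap k L b₂)) := by
    simp only [D.leibniz, D.leibniz_pow, map_sub, ht, smul_eq_mul, nsmul_eq_mul, D.map_algebraMap]
    push_cast
    ring
  -- With `Q = (t - b₁) (t - b₂)`, one has `V / (t² Q) = (t Q)^(-p) · V t^(p-2) Q^(p-1)`, which
  -- `D^p` kills.
  have hDpW : D^[p - 1] (D (aeval t V /
      (t ^ 2 * ((t - algebraMap k L b₁) * (t - algebraMap k L b₂))))) = 0 := by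
    rw [← Function.iterate_succ_apply, Nat.succ_eq_add_one, hp1]
    convert! D.iterate_char_pow_mul_aeval hp ht
      (V * X ^ (p - 2) * ((X - C b₁) * (X - C b₂)) ^ (p - 1))
      (t * ((t - algebraMap k L b₁) * (t - algebraMap k L b₂)))⁻¹ using 2
    obtain ⟨q, hq⟩ : ∃ q, p = q + 2 := ⟨p - 2, by omega⟩
    have e1 : p - 1 = q + 1 := by omega
    have e2 : p - 2 = q := by omega
    simp only [map_mul, map_sub, map_pow, aeval_X, aeval_C]
    rw [e1, e2, hq]
    generalize algebraMap k L b₁ = c₁ at *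
    generalize algebraMap k L b₂ = c₂ at *
    simp only [inv_pow, mul_pow]
    field_simp
    ring
  simp only [map_add, map_mul, map_sub, map_pow, aeval_X, aeval_C, map_one, map_ofNat] at *
  generalize algebraMap k L b₁ = c₁ at *
  generalize algebraMap k L b₂ = c₂ at *
  generalize algebraMap k L l = β at *
  generalize algebraMap k L ρ = r at *
  generalize aeval t V = v at *
  generalize aeval t (derivative V) = v' at *
  have hDW : ((t - 1) * (t - β) * t ^ 3 * ((t - c₁) * (t - c₂)) ^ 2)⁻¹ =
      r * ((β - 1)⁻¹ * ((t - β)⁻¹ - (t - 1)⁻¹)) + D (v / (t ^ 2 * ((t - c₁) * (t - c₂)))) := by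
    rw [D.leibniz_div, hDv, hD1]
    simp only [smul_eq_mul]
    have e : (β - 1)⁻¹ * ((t - β)⁻¹ - (t - 1)⁻¹) = ((t - 1) * (t - β))⁻¹ := by
      field_simp
      ring
    rw [e]
    field_simp
    linear_combination (-1 : L) * hV'
  -- Since `z = z ^ p / z ^ (p - 1)`, the irrational part of `u` is moved into a factor that is
  -- constant for `D`.
  have hu : z / ((t - 1) * (t - β)) = (z ^ p * (r * (β - 1) ^ (p - 1))⁻¹) *
      ((t - 1) * (t - β) * t ^ 3 * ((t - c₁) * (t - c₂)) ^ 2)⁻¹ := by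
    have : z ^ p = z * (r * (β - 1) ^ (p - 1) * t ^ 3 * ((t - c₁) * (t - c₂)) ^ 2) := by
      rw [← hz, ← pow_succ', hp1]
    rw [this]
    field_simp
  have := Fact.mk hp
  -- By additivity of Frobenius this is `(β - 1) ^ p`; it accounts for the factor `(l - 1) ^ (p -
  -- 1)` in the Kummer equation.
  have hsub : (t - 1) ^ p - (t - β) ^ p = (β - 1) * (β - 1) ^ (p - 1) := by
    rw [← sub_pow_char, ← pow_succ', hp1]
    congr 1
    ring
  have hpow : ∀ x : L, x ≠ 0 → x ^ p ≠ 0 := fun x hx => pow_ne_zero p hx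
  have hq := pow_ne_zero (p - 1) hβ
  rw [div_pow, mul_pow]
  rw [hu, D.iterate_mul_of_eq_zero hDc, hDW, iterate_map_add, hDpW, add_zero,
    D.iterate_mul_of_eq_zero hDρ, D.iterate_mul_of_eq_zero hDl, iterate_map_sub, hi1, hil]
  have e : -((t - β)⁻¹ ^ p) - -((t - 1)⁻¹ ^ p) =
      -((β - 1) * (β - 1) ^ (p - 1)) / ((t - 1) ^ p * (t - β) ^ p) := by
    have h2 := hpow _ h1
    have h3 := hpow _ hl'
    rw [← hsub, inv_pow, inv_pow]
    field_simp
    ring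
  rw [e]
  have h2 := hpow _ h1
  have h3 := hpow _ hl'
  generalize (β - 1) ^ (p - 1) = w at *
  field_simp

end Logarithmic

/-! ### Deformation data on Kummer covers and their `σ`. -/

section KummerDatum

open Polynomial

/-- The deformation datum `ω = w z dt` on the Kummer cover `z ^ (p - 1) = f`. -/
theorem DeformationDatum.exists_of_kummer {p : ℕ} (hp : p.Prime) {k : Type u} [Field k]
    [CharP k p] {f w : RatFunc k} (hf0 : f ≠ 0) (hw : w ≠ 0)
    (hf : ∀ (h : ℕ) (g : RatFunc k), f ^ h = g ^ (p - 1) → p - 1 ∣ h)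
    (hlog : ∀ (L : Type u) [Field L] [Algebra k L] [Algebra (RatFunc k) L]
      [IsScalarTower k (RatFunc k) L] (D : Derivation k L L) (z : L),
      D (algebraMap (RatFunc k) L RatFunc.X) = 1 → z ^ (p - 1) = algebraMap (RatFunc k) L f →
      ∃ v, v ≠ 0 ∧ D v = algebraMap (RatFunc k) L w * z * v) :
    ∃ (d : DeformationDatum p k (RatFunc k)) (z : d.L)
      (χ : (d.L ≃ₐ[RatFunc k] d.L) ≃* (ZMod p)ˣ),
      z ^ (p - 1) = algebraMap (RatFunc k) d.L f ∧
      IntermediateField.adjoin (RatFunc k) {z} = ⊤ ∧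
      (∀ τ, τ z = algebraMap k d.L ((χ τ : ZMod p).cast) * z) ∧
      d.ω = (algebraMap (RatFunc k) d.L w * z) •
        KaehlerDifferential.D k d.L (algebraMap (RatFunc k) d.L RatFunc.X) := by
  have := Fact.mk hp
  have hK : CharP (RatFunc k) p := charP_of_injective_algebraMap (algebraMap k (RatFunc k)).injective p
  set L := (X ^ (p - 1) - C f : (RatFunc k)[X]).SplittingField with hL
  obtain ⟨hgal, z, χ, hz, hgen, hχ⟩ := exists_kummer_generator hp hf0 hf L
  have hfin : FiniteDimensional (RatFunc k) L :=
    IsSplittingField.finiteDimensional L (X ^ (p - 1) - C f : (RatFunc k)[X])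
  obtain ⟨D, hD1, ht0, hD⟩ := exists_derivation_of_ratFunc k L
  set t := algebraMap (RatFunc k) L RatFunc.X with ht
  have hp1 : p - 1 ≠ 0 := by have := hp.two_le; omega
  have hz0 : z ≠ 0 := by
    rintro rfl
    rw [zero_pow hp1] at hz
    exact hf0 ((map_eq_zero _).mp hz.symm)
  have hχ' : ∀ τ : L ≃ₐ[RatFunc k] L, τ z = algebraMap k L ((χ τ : ZMod p).cast) * z := by
    intro τ
    rw [hχ τ]
    congr 1
    exact congrArg (fun φ : ZMod p →+* L => φ (χ τ : ZMod p)) (Subsingleton.elim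
      ((algebraMap (RatFunc k) L).comp (ZMod.castHom dvd_rfl (RatFunc k)))
      ((algebraMap k L).comp (ZMod.castHom dvd_rfl k)))
  have hw0 : algebraMap (RatFunc k) L w ≠ 0 := (_root_.map_ne_zero _).mpr hw
  refine ⟨{ L := L
            tame := ?_
            ω := (algebraMap (RatFunc k) L w * z) • KaehlerDifferential.D k L t
            ω_ne_zero := ?_
            χ := χ.toMonoidHom
            χ_injective := χ.injective
            pullback_ω := ?_
            logarithmic := ?_ }, z, χ, hz, hgen, hχ', rfl⟩
  · intro B
    have h1 : B.stabilizerCard (RatFunc k) ∣ p - 1 := by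
      have h2 := (B.ring.decompositionSubgroup (RatFunc k)).card_subgroup_dvd_card
      rwa [Nat.card_congr χ.toEquiv, Nat.card_eq_fintype_card (α := (ZMod p)ˣ),
        ZMod.card_units] at h2
    refine Nat.Coprime.coprime_dvd_right h1 ?_
    refine (Nat.coprime_of_lt_prime hp1 ?_ hp)
    have := hp.two_le
    omega
  · intro h
    rcases smul_eq_zero.mp h with h | h
    · exact mul_ne_zero hw0 hz0 h
    · exact ht0 h
  · intro τ
    rw [differentialPullback_smul_D]
    change τ _ • KaehlerDifferential.D k L (τ t) = _
    rw [ht, τ.commutes, map_mul, τ.commutes, hχ' τ, mul_left_comm, mul_smul, algebraMap_smul]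
    rfl
  · obtain ⟨v, hv0, hv⟩ := hlog L D z hD1 hz
    refine ⟨v, hv0, ?_⟩
    rw [hD v, hv, smul_smul, mul_comm _ v, inv_mul_cancel_left₀ hv0]

theorem adjoin_pair_eq_top {k K L : Type u} [Field k] [Field K] [Field L] [Algebra k K]
    [Algebra k L] [Algebra K L] [IsScalarTower k K L] {π : K} {z : L}
    (hπ : IntermediateField.adjoin k {π} = ⊤) (hz : IntermediateField.adjoin K {z} = ⊤) :
    IntermediateField.adjoin k {algebraMap K L π, z} = ⊤ := by
  set F := IntermediateField.adjoin k {algebraMap K L π, z} with hF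
  have hK : ∀ b : K, algebraMap K L b ∈ F := by
    intro b
    have hb : b ∈ IntermediateField.adjoin k {π} := by
      rw [hπ]; exact IntermediateField.mem_top
    induction hb using IntermediateField.adjoin_induction with
    | mem x hx =>
      rw [Set.mem_singleton_iff.mp hx]
      exact IntermediateField.subset_adjoin _ _ (by simp)
    | algebraMap c =>
      rw [← IsScalarTower.algebraMap_apply]
      exact F.algebraMap_mem c
    | add x y _ _ hx hy => rw [map_add]; exact add_mem hx hy
    | mul x y _ _ hx hy => rw [map_mul]; exact mul_mem hx hy
    | inv x _ hx => rw [map_inv₀]; exact inv_mem hx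
  refine eq_top_iff.mpr fun x _ => ?_
  have hx : x ∈ IntermediateField.adjoin K {z} := by
    rw [hz]; exact IntermediateField.mem_top
  induction hx using IntermediateField.adjoin_induction with
  | mem x hx =>
    rw [Set.mem_singleton_iff.mp hx]
    exact IntermediateField.subset_adjoin _ _ (by simp)
  | algebraMap c => exact hK c
  | add x y _ _ hx hy => exact add_mem (hx trivial) (hy trivial)
  | mul x y _ _ hx hy => exact mul_mem (hx trivial) (hy trivial)
  | inv x _ hx => exact inv_mem (hx trivial)

namespace DeformationDatum

variable {p : ℕ} {k K : Type u} [Field k] [IsAlgClosed k] [CharP k p] [Field K] [Algebra k K]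

/-- The value of `σ` at a point with local coordinate `π`, for a datum `ω = w z dt` on the Kummer
cover `z ^ (p - 1) = f`. -/
theorem sigma_eq (hp : p.Prime) (d : DeformationDatum p k K) {z : d.L} {f : K}
    (hz : z ^ (p - 1) = algebraMap K d.L f) (hgen : IntermediateField.adjoin K {z} = ⊤)
    (χ : (d.L ≃ₐ[K] d.L) ≃* (ZMod p)ˣ)
    (hχ : ∀ τ, τ z = algebraMap k d.L ((χ τ : ZMod p).cast) * z)
    (x : CurvePlace k K) {π : K} (hπ0 : π ≠ 0) (hπgen : IntermediateField.adjoin k {π} = ⊤)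
    (hx : x.ring.valuation π < 1) {n l : ℤ} {h₁ h₂ h₃ h₄ : k[X]} (he1 : h₁.eval 0 ≠ 0)
    (he2 : h₂.eval 0 ≠ 0) (he3 : h₃.eval 0 ≠ 0) (he4 : h₄.eval 0 ≠ 0)
    (hf : f = π ^ n * (aeval π h₁ / aeval π h₂))
    (hω : d.ω = (algebraMap K d.L (π ^ l * (aeval π h₃ / aeval π h₄)) * z) •
      KaehlerDifferential.D k d.L (algebraMap K d.L π)) :
    d.sigma x = l + 1 + n / ((p : ℚ) - 1) := by
  have habove : (d.above x).LiesAbove x := (CurvePlace.exists_liesAbove (L := d.L) x).choose_spec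
  refine (d.above x).ord_add_one_div_stabilizerCard hp (K := K)
    (π := algebraMap K d.L π) (z := z) (by simpa using hπ0)
    ((habove.valuation_lt_one_iff hπ0).mpr hx) he1 he2 he3 he4 ?_
    (adjoin_pair_eq_top hπgen hgen) d.ω_ne_zero ?_ χ (fun τ => τ.commutes π) hχ
  · rw [hz, hf]
    simp only [map_mul, map_div₀, map_zpow₀, aeval_algebraMap_apply]
  · rw [hω]
    simp only [map_mul, map_div₀, map_zpow₀, aeval_algebraMap_apply]

end DeformationDatum

end KummerDatum

section SigmaDatum

open Polynomial

theorem RatFunc.algebraMap_eq_aeval_X {k : Type u} [Field k] (q : k[X]) :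
    algebraMap k[X] (RatFunc k) q = aeval RatFunc.X q := by
  rw [← RatFunc.algebraMap_X, aeval_algebraMap_apply, aeval_X_left, AlgHom.id_apply]

namespace DeformationDatum

variable {p : ℕ} {k : Type u} [Field k] [IsAlgClosed k] [CharP k p]

/-- The value of `σ` at `t = a` for the datum `ω = z dt / P` where `z ^ (p - 1) = F`. -/
theorem sigma_finitePlace (hp : p.Prime) (d : DeformationDatum p k (RatFunc k)) {z : d.L}
    {F P : k[X]} (hz : z ^ (p - 1) = algebraMap (RatFunc k) d.L (algebraMap k[X] (RatFunc k) F))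
    (hgen : IntermediateField.adjoin (RatFunc k) {z} = ⊤)
    (χ : (d.L ≃ₐ[RatFunc k] d.L) ≃* (ZMod p)ˣ)
    (hχ : ∀ τ, τ z = algebraMap k d.L ((χ τ : ZMod p).cast) * z)
    (hω : d.ω = (algebraMap (RatFunc k) d.L (algebraMap k[X] (RatFunc k) P)⁻¹ * z) •
        KaehlerDifferential.D k d.L (algebraMap (RatFunc k) d.L RatFunc.X))
    (a : k) {n j : ℕ} {G R : k[X]} (hG : G.eval a ≠ 0) (hR : R.eval a ≠ 0)
    (hF : F = (X - C a) ^ n * G) (hP : P = (X - C a) ^ j * R) :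
    d.sigma (ProjectiveLine.finitePlace a) = 1 - j + n / ((p : ℚ) - 1) := by
  -- Polynomials in `t` are rewritten in the local coordinate `t - a` by the shift `X + a`.
  have hcomp : ∀ q : k[X], algebraMap k[X] (RatFunc k) q =
      aeval (RatFunc.X - RatFunc.C a : RatFunc k) (q.comp (X + C a)) := by
    intro q
    rw [aeval_comp, map_add, aeval_X, aeval_C, RatFunc.algebraMap_eq_C, sub_add_cancel,
      RatFunc.algebraMap_eq_aeval_X]
  have hX : algebraMap k[X] (RatFunc k) (X - C a) = RatFunc.X - RatFunc.C a := by
    rw [map_sub, RatFunc.algebraMap_X, RatFunc.algebraMap_C]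
  have hev : ∀ q : k[X], (q.comp (X + C a)).eval 0 = q.eval a := fun q => by simp
  rw [d.sigma_eq hp (n := n) (l := -j) (h₁ := G.comp (X + C a)) (h₂ := 1) (h₃ := 1)
    (h₄ := R.comp (X + C a)) hz hgen χ hχ (ProjectiveLine.finitePlace a)
    (ProjectiveLine.X_sub_C_ne_zero a) (ProjectiveLine.adjoin_X_sub_C_eq_top a)
    (ProjectiveLine.valuation_finitePlace_X_sub_C a) (by rwa [hev]) (by simp) (by simp)
    (by rwa [hev])]
  · push_cast
    ring
  · rw [← hcomp, hF, map_mul, map_pow, hX, map_one, div_one, zpow_natCast]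
  · rw [hω, hP, ← hcomp, map_mul, map_pow, hX, map_one, zpow_neg, zpow_natCast, one_div, mul_inv,
      map_sub (algebraMap (RatFunc k) d.L), map_sub, ← RatFunc.algebraMap_eq_C,
      ← IsScalarTower.algebraMap_apply, Derivation.map_algebraMap, sub_zero]

/-- The value of `σ` at infinity for the datum `ω = z dt / ((t - 1) (t - l))` where
`z ^ (p - 1) = c t³ (t - b₁)² (t - b₂)²`. -/
theorem sigma_inftyPlace (hp : p.Prime) (d : DeformationDatum p k (RatFunc k)) {z : d.L}
    {c l b₁ b₂ : k} (hc : c ≠ 0)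
    (hz : z ^ (p - 1) = algebraMap (RatFunc k) d.L (algebraMap k[X] (RatFunc k)
      (C c * X ^ 3 * ((X - C b₁) * (X - C b₂)) ^ 2)))
    (hgen : IntermediateField.adjoin (RatFunc k) {z} = ⊤)
    (χ : (d.L ≃ₐ[RatFunc k] d.L) ≃* (ZMod p)ˣ)
    (hχ : ∀ τ, τ z = algebraMap k d.L ((χ τ : ZMod p).cast) * z)
    (hω : d.ω = (algebraMap (RatFunc k) d.L (algebraMap k[X] (RatFunc k)
        ((X - C 1) * (X - C l)))⁻¹ * z) •
        KaehlerDifferential.D k d.L (algebraMap (RatFunc k) d.L RatFunc.X)) :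
    d.sigma (ProjectiveLine.inftyPlace k) = 1 - 7 / ((p : ℚ) - 1) := by
  have hX0 : (RatFunc.X : RatFunc k) ≠ 0 := RatFunc.X_ne_zero
  -- With `π = 1/t`, the degree `3 + 2 + 2` gives `n = -7`. The factor `-π⁻²` in `dt = -π⁻² dπ`
  -- meets `π²` from `1 / ((t - 1) (t - l))`, leaving `π`-exponent `0` and the sign `-1`.
  rw [d.sigma_eq hp (n := -7) (l := 0) (h₁ := C c * ((1 - C b₁ * X) * (1 - C b₂ * X)) ^ 2)
    (h₂ := 1) (h₃ := -1) (h₄ := (1 - C 1 * X) * (1 - C l * X)) hz hgen χ hχ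
    (ProjectiveLine.inftyPlace k) (inv_ne_zero hX0) ProjectiveLine.adjoin_inv_X_eq_top
    ProjectiveLine.valuation_inftyPlace_inv_X (by simpa using hc) (by simp) (by simp) (by simp)]
  · push_cast
    ring
  · rw [RatFunc.algebraMap_eq_aeval_X]
    simp only [map_mul, map_sub, map_pow, aeval_X, aeval_C, map_one, div_one]
    have hpow : (RatFunc.X⁻¹ : RatFunc k) ^ (-7 : ℤ) = RatFunc.X ^ (7 : ℕ) := by
      rw [inv_zpow, zpow_neg, inv_inv]
      exact zpow_natCast _ 7
    rw [hpow]
    have e : ∀ b : RatFunc k, RatFunc.X - b = RatFunc.X * (1 - b * RatFunc.X⁻¹) := fun b => by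
      field_simp
    rw [e (algebraMap k (RatFunc k) b₁), e (algebraMap k (RatFunc k) b₂)]
    ring
  · rw [hω, map_inv₀ (algebraMap (RatFunc k) d.L) RatFunc.X, Derivation.leibniz_inv, smul_smul]
    congr 1
    rw [RatFunc.algebraMap_eq_aeval_X]
    simp only [map_mul, map_sub, map_neg, aeval_X, aeval_C, map_one, zpow_zero, one_mul, map_inv₀,
      map_div₀]
    set t := algebraMap (RatFunc k) d.L RatFunc.X
    have ht0 : t ≠ 0 := (_root_.map_ne_zero _).mpr hX0
    have e : ∀ b : d.L, t - b = t * (1 - b * t⁻¹) := fun b => by field_simp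
    rw [e, e, ← one_mul t⁻¹]
    simp only [one_mul]
    generalize 1 - _ * t⁻¹ = A
    generalize 1 - t⁻¹ = A'
    rw [mul_inv, mul_inv, mul_inv, div_eq_mul_inv, mul_inv]
    field_simp

end DeformationDatum

theorem Rat.not_dvd_num_div {p : ℕ} {a b : ℤ} (hb : b ≠ 0) (ha : ¬ (p : ℤ) ∣ a) :
    ¬ (p : ℤ) ∣ ((a : ℚ) / b).num := fun h => ha <| by
  rw [← Rat.divInt_eq_div] at h
  exact h.trans (Rat.num_dvd a hb)

end SigmaDatum

/-! ### The datum attached to a residue-free configuration. -/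

section FourPointDatum

open Polynomial

/-- In a residue-free configuration the points `0, 1, l, b₁, b₂` are distinct. -/
theorem ne_of_residue_free_configuration {k : Type u} [Field k] {l b₁ b₂ ρ : k} {V : k[X]}
    (hl : l ≠ 1)
    (hV : C ρ * X ^ 3 * ((X - C b₁) * (X - C b₂)) ^ 2 + (X - C 1) * (X - C l) *
      (X * ((X - C b₁) * (X - C b₂)) * derivative V -
        V * (2 * ((X - C b₁) * (X - C b₂)) + X * (2 * X - C (b₁ + b₂)))) = 1) :
    ρ ≠ 0 ∧ l ≠ 0 ∧ b₁ ≠ 0 ∧ b₂ ≠ 0 ∧ b₁ ≠ 1 ∧ b₂ ≠ 1 ∧ b₁ ≠ l ∧ b₂ ≠ l ∧ b₁ ≠ b₂ := by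
  have h0 := congrArg (eval 0) hV
  have h1 := congrArg (eval 1) hV
  have hb₁ := congrArg (eval b₁) hV
  have hb₂ := congrArg (eval b₂) hV
  simp at h0 h1 hb₁ hb₂
  -- The values at `0`, `1` and `b₁` read `-2 l b₁ b₂ V(0) = 1`, `ρ (1 - b₁)² (1 - b₂)² = 1` and
  -- `-b₁ (b₁ - b₂) (b₁ - 1) (b₁ - l) V(b₁) = 1`, and `b₂` is symmetric; each coincidence would give
  -- `0 = 1`.
  refine ⟨?_, ?_, ?_, ?_, ?_, ?_, ?_, ?_, ?_⟩ <;> rintro rfl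
  · simp at h1
  · simp at h0
  · simp at h0
  · simp at h0
  · simp at hb₁
  · simp at hb₂
  · simp at hb₁
  · simp at hb₂
  · refine zero_ne_one (Eq.trans ?_ hb₁)
    ring

namespace ProjectiveLine

variable {k : Type u} [Field k]

/-- The order at `t = a` of an `N`-th root of `f ^ h` is an integer. -/
theorem dvd_mul_of_pow_eq_pow {a : k} {n : ℕ} {F G : k[X]} (hG : G.eval a ≠ 0)
    (hF : F = (X - C a) ^ n * G) {h N : ℕ} {g : RatFunc k} (hg : g ≠ 0)
    (hfg : algebraMap k[X] (RatFunc k) F ^ h = g ^ N) : N ∣ n * h := by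
  have hX : algebraMap k[X] (RatFunc k) (X - C a) = RatFunc.X - RatFunc.C a := by
    rw [map_sub, RatFunc.algebraMap_X, RatFunc.algebraMap_C]
  have hG' : algebraMap k[X] (RatFunc k) G =
      aeval (RatFunc.X - RatFunc.C a : RatFunc k) (G.comp (X + C a)) := by
    rw [aeval_comp, map_add, aeval_X, aeval_C, RatFunc.algebraMap_eq_C, sub_add_cancel,
      RatFunc.algebraMap_eq_aeval_X]
  have key := (finitePlace a).dvd_mul_of_pow_eq_pow (n := n) (h₁ := G.comp (X + C a)) (h₂ := 1)
    (h := h) (N := N) (X_sub_C_ne_zero a) (adjoin_X_sub_C_eq_top a)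
    (valuation_finitePlace_X_sub_C a) (by simpa using hG) (by simp) hg (by
      rw [← hfg, hF, map_mul, map_pow, hX, hG', map_one, div_one, zpow_natCast])
  exact_mod_cast key

end ProjectiveLine

variable {p : ℕ} {k : Type u} [Field k] [CharP k p]

/-- The deformation datum `ω = z dt / ((t - 1) (t - l))` with `z ^ (p - 1) = c t³ (t - b₁)² (t - b₂)²`
attached to a residue-free configuration. -/
theorem DeformationDatum.exists_four_point_kummer (hp : p.Prime) (hp2 : 2 < p)
    {l b₁ b₂ ρ : k} {V : k[X]} (hl : l ≠ 1)
    (hV : C ρ * X ^ 3 * ((X - C b₁) * (X - C b₂)) ^ 2 + (X - C 1) * (X - C l) *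
      (X * ((X - C b₁) * (X - C b₂)) * derivative V -
        V * (2 * ((X - C b₁) * (X - C b₂)) + X * (2 * X - C (b₁ + b₂)))) = 1) :
    ∃ (d : DeformationDatum p k (RatFunc k)) (z : d.L)
      (χ : (d.L ≃ₐ[RatFunc k] d.L) ≃* (ZMod p)ˣ),
      z ^ (p - 1) = algebraMap (RatFunc k) d.L (algebraMap k[X] (RatFunc k)
        (C (ρ * (l - 1) ^ (p - 1)) * X ^ 3 * ((X - C b₁) * (X - C b₂)) ^ 2)) ∧
      IntermediateField.adjoin (RatFunc k) {z} = ⊤ ∧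
      (∀ τ, τ z = algebraMap k d.L ((χ τ : ZMod p).cast) * z) ∧
      d.ω = (algebraMap (RatFunc k) d.L (algebraMap k[X] (RatFunc k)
          ((X - C 1) * (X - C l)))⁻¹ * z) •
        KaehlerDifferential.D k d.L (algebraMap (RatFunc k) d.L RatFunc.X) := by
  obtain ⟨hρ, hl0, hb₁, hb₂, -, -, -, -, hb⟩ := ne_of_residue_free_configuration hl hV
  set F : k[X] := C (ρ * (l - 1) ^ (p - 1)) * X ^ 3 * ((X - C b₁) * (X - C b₂)) ^ 2 with hF
  have hc : ρ * (l - 1) ^ (p - 1) ≠ 0 := mul_ne_zero hρ (pow_ne_zero _ (sub_ne_zero.mpr hl))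
  have hF0 : F ≠ 0 :=
    mul_ne_zero (mul_ne_zero (C_ne_zero.mpr hc) (pow_ne_zero _ X_ne_zero))
      (pow_ne_zero _ (mul_ne_zero (X_sub_C_ne_zero b₁) (X_sub_C_ne_zero b₂)))
  have hP0 : (X - C 1) * (X - C l) ≠ (0 : k[X]) :=
    mul_ne_zero (X_sub_C_ne_zero 1) (X_sub_C_ne_zero l)
  have hf0 : algebraMap k[X] (RatFunc k) F ≠ 0 := RatFunc.algebraMap_ne_zero hF0
  refine DeformationDatum.exists_of_kummer hp hf0 (inv_ne_zero (RatFunc.algebraMap_ne_zero hP0))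
    ?_ ?_
  · intro h g hg
    have hg0 : g ≠ 0 := by
      rintro rfl
      rw [zero_pow (by omega)] at hg
      exact pow_ne_zero _ hf0 hg
    -- The orders `3` at `0` and `2` at `b₁` are coprime: `p - 1` divides `3 h` and `2 h`, hence
    -- `h`. This makes the cover connected of full degree `p - 1`.
    have h3 : p - 1 ∣ 3 * h := ProjectiveLine.dvd_mul_of_pow_eq_pow (a := (0 : k))
      (G := C (ρ * (l - 1) ^ (p - 1)) * ((X - C b₁) * (X - C b₂)) ^ 2)
      (by simp [hρ, sub_ne_zero.mpr hl, hb₁, hb₂]) (by rw [hF, C_0]; ring) hg0 hg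
    have h2 : p - 1 ∣ 2 * h := ProjectiveLine.dvd_mul_of_pow_eq_pow (a := b₁)
      (G := C (ρ * (l - 1) ^ (p - 1)) * X ^ 3 * (X - C b₂) ^ 2)
      (by simp [hρ, sub_ne_zero.mpr hl, hb₁, sub_ne_zero.mpr hb]) (by rw [hF]; ring) hg0 hg
    have := Nat.dvd_sub h3 h2
    rwa [← Nat.sub_mul, show 3 - 2 = 1 from rfl, one_mul] at this
  · intro L _ _ _ _ D z hD hz
    have : CharP L p := charP_of_injective_algebraMap (algebraMap k L).injective p
    have hae : ∀ q : k[X], algebraMap (RatFunc k) L (algebraMap k[X] (RatFunc k) q) =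
        aeval (algebraMap (RatFunc k) L RatFunc.X) q := fun q => by
      rw [RatFunc.algebraMap_eq_aeval_X, aeval_algebraMap_apply]
    have htr : ∀ a : k, algebraMap (RatFunc k) L RatFunc.X - algebraMap k L a ≠ 0 := fun a => by
      rw [IsScalarTower.algebraMap_apply k (RatFunc k) L, ← map_sub, _root_.map_ne_zero,
        RatFunc.algebraMap_eq_C]
      exact ProjectiveLine.X_sub_C_ne_zero a
    obtain ⟨v, hv, hDv⟩ := Derivation.exists_logarithmic hp D
      (D.iterate_pred_char_eq_neg_pow hp hp2 hD htr hl hρ hV (by rw [hz, hae]))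
    exact ⟨v, hv, by rw [hDv, map_inv₀, hae, div_eq_inv_mul]⟩

end FourPointDatum

/-! ### The theorem. -/

theorem mainTheorem8 (p : ℕ) (hp : p.Prime) (hp11 : 11 ≤ p) (k : Type u) [Field k]
    [IsAlgClosed k] [CharP k p] :
    ∃ l : k, l ≠ 0 ∧ l ≠ 1 ∧ ∃ d : DeformationDatum p k (RatFunc k),
      d.IsSpecial ∧
      {x | d.IsSingular x} =
        {ProjectiveLine.finitePlace 1, ProjectiveLine.finitePlace l,
          ProjectiveLine.inftyPlace k, ProjectiveLine.finitePlace 0} ∧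
      d.signatureSet = {x | d.IsSingular x} ∧
      d.sigma (ProjectiveLine.finitePlace 1) = 0 ∧
      d.sigma (ProjectiveLine.finitePlace l) = 0 ∧
      d.sigma (ProjectiveLine.inftyPlace k) = ((p : ℚ) - 8) / ((p : ℚ) - 1) ∧
      d.sigma (ProjectiveLine.finitePlace 0) = ((p : ℚ) + 2) / ((p : ℚ) - 1) := by
  have hcast : ∀ n : ℕ, 0 < n → n < 11 → (n : k) ≠ 0 := fun n hn hn' h => by
    rw [CharP.cast_eq_zero_iff k p] at h
    have := Nat.le_of_dvd hn h
    omega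
  obtain ⟨l, b₁, b₂, ρ, V, hl, hV⟩ := exists_residue_free_configuration (k := k)
    (by exact_mod_cast hcast 2 (by norm_num) (by norm_num))
    (by exact_mod_cast hcast 3 (by norm_num) (by norm_num))
    (by exact_mod_cast hcast 5 (by norm_num) (by norm_num))
    (by exact_mod_cast hcast 7 (by norm_num) (by norm_num))
  obtain ⟨hρ, hl0, hb₁, hb₂, hb₁1, hb₂1, hb₁l, hb₂l, hb⟩ :=
    ne_of_residue_free_configuration hl hV
  obtain ⟨d, z, χ, hz, hgen, hχ, hω⟩ :=
    DeformationDatum.exists_four_point_kummer hp (by omega) hl hV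
  have hl' : l - 1 ≠ 0 := sub_ne_zero.mpr hl
  have hc : ρ * (l - 1) ^ (p - 1) ≠ 0 := mul_ne_zero hρ (pow_ne_zero _ hl')
  have hp1 : (0 : ℚ) < (p : ℚ) - 1 := by
    have : (11 : ℚ) ≤ p := by exact_mod_cast hp11
    linarith
  have hp11' : (11 : ℚ) ≤ p := by exact_mod_cast hp11
  open Polynomial in
  have s := fun (a : k) (n j : ℕ) (G R : k[X]) =>
    d.sigma_finitePlace hp (n := n) (j := j) (G := G) (R := R) hz hgen χ hχ hω a
  open Polynomial in
  have s0 : d.sigma (ProjectiveLine.finitePlace 0) = ((p : ℚ) + 2) / ((p : ℚ) - 1) := by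
    rw [s 0 3 0 (C (ρ * (l - 1) ^ (p - 1)) * ((X - C b₁) * (X - C b₂)) ^ 2)
      ((X - C 1) * (X - C l)) (by simp [hρ, hl', hb₁, hb₂]) (by simp [hl0])
      (by rw [C_0]; ring) (by ring)]
    field_simp
    push_cast
    ring
  open Polynomial in
  have s1 : d.sigma (ProjectiveLine.finitePlace 1) = 0 := by
    rw [s 1 0 1 (C (ρ * (l - 1) ^ (p - 1)) * X ^ 3 * ((X - C b₁) * (X - C b₂)) ^ 2)
      (X - C l) (by simp [hρ, hl', sub_eq_zero, hb₁1.symm, hb₂1.symm])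
      (by simp [sub_eq_zero, hl.symm]) (by rw [pow_zero, one_mul]) (by ring)]
    simp
  open Polynomial in
  have sl : d.sigma (ProjectiveLine.finitePlace l) = 0 := by
    rw [s l 0 1 (C (ρ * (l - 1) ^ (p - 1)) * X ^ 3 * ((X - C b₁) * (X - C b₂)) ^ 2)
      (X - C 1) (by simp [hρ, hl', sub_eq_zero, hb₁l.symm, hb₂l.symm, hl0])
      (by simp [hl']) (by rw [pow_zero, one_mul]) (by ring)]
    simp
  open Polynomial in
  have sb₁ : d.IsSupersingular (ProjectiveLine.finitePlace b₁) := by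
    rw [DeformationDatum.IsSupersingular, s b₁ 2 0
      (C (ρ * (l - 1) ^ (p - 1)) * X ^ 3 * (X - C b₂) ^ 2) ((X - C 1) * (X - C l))
      (by simp [hρ, hl', hb₁, sub_eq_zero, hb])
      (by simp [sub_eq_zero, hb₁1, hb₁l]) (by ring) (by ring)]
    field_simp
    push_cast
    ring
  open Polynomial in
  have sb₂ : d.IsSupersingular (ProjectiveLine.finitePlace b₂) := by
    rw [DeformationDatum.IsSupersingular, s b₂ 2 0
      (C (ρ * (l - 1) ^ (p - 1)) * X ^ 3 * (X - C b₁) ^ 2) ((X - C 1) * (X - C l))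
      (by simp [hρ, hl', hb₂, sub_eq_zero, hb.symm])
      (by simp [sub_eq_zero, hb₂1, hb₂l]) (by ring) (by ring)]
    field_simp
    push_cast
    ring
  have sinf : d.sigma (ProjectiveLine.inftyPlace k) = ((p : ℚ) - 8) / ((p : ℚ) - 1) := by
    rw [d.sigma_inftyPlace hp hc hz hgen χ hχ hω]
    field_simp
    ring
  open Polynomial in
  have sgen : ∀ a : k, a ≠ 0 → a ≠ 1 → a ≠ l → a ≠ b₁ → a ≠ b₂ →
      d.sigma (ProjectiveLine.finitePlace a) = 1 := by
    intro a h0 h1 h2 h3 h4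
    rw [s a 0 0 (C (ρ * (l - 1) ^ (p - 1)) * X ^ 3 * ((X - C b₁) * (X - C b₂)) ^ 2)
      ((X - C 1) * (X - C l)) (by simp [hρ, hl', sub_eq_zero, h0, h3, h4])
      (by simp [sub_eq_zero, h1, h2]) (by rw [pow_zero, one_mul]) (by rw [pow_zero, one_mul])]
    simp
  set S : Set (CurvePlace k (RatFunc k)) := {ProjectiveLine.finitePlace 1,
    ProjectiveLine.finitePlace l, ProjectiveLine.inftyPlace k, ProjectiveLine.finitePlace 0} with hS
  -- For `∞` and `0`, `σ - 1` has numerators `-7` and `3` over `p - 1`, nonzero and smaller in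
  -- absolute value than `11 ≤ p`.
  have hndvd : ∀ a : ℤ, a ≠ 0 → |a| < 11 → ¬ (p : ℤ) ∣ (((a : ℚ)) / ((p : ℚ) - 1)).num := by
    intro a ha0 ha h
    have := Rat.not_dvd_num_div (p := p) (a := a) (b := (p : ℤ) - 1) (by omega) (fun h' => by
      have := Int.le_of_dvd (abs_pos.mpr ha0) ((dvd_abs _ _).mpr h')
      omega)
    push_cast at this
    exact this h
  have hmem : ∀ x ∈ S, d.sigma x ≠ 1 ∧ d.IsSingular x := by
    intro x hx
    -- The supersingular value is `σ - 1 = 2 / (p - 1)`, which is why `a = 2` is excluded.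
    have main : ∀ a : ℤ, a ≠ 0 → a ≠ 2 → |a| < 11 → d.sigma x - 1 = (a : ℚ) / ((p : ℚ) - 1) →
        d.sigma x ≠ 1 ∧ d.IsSingular x := by
      intro a ha0 ha2 ha h
      refine ⟨fun h1 => ?_, fun h1 => ?_, ?_⟩
      · rw [h1, sub_self, eq_comm, div_eq_zero_iff] at h
        exact h.elim (fun h => ha0 (by exact_mod_cast h)) hp1.ne'
      · rw [h1] at h
        refine ha2 ?_
        field_simp at h
        have : (a : ℚ) = 2 := by linarith
        exact_mod_cast this
      · rw [h]
        exact hndvd a ha0 ha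
    rw [hS] at hx
    obtain rfl | rfl | rfl | rfl := hx
    · refine ⟨by rw [s1]; exact zero_ne_one, ?_, ?_⟩
      · rw [DeformationDatum.IsSupersingular, s1]
        exact (div_pos (by linarith) hp1).ne
      · rw [s1]
        exact fun h => by
          have := Int.le_of_dvd one_pos (by simpa using h)
          omega
    · refine ⟨by rw [sl]; exact zero_ne_one, ?_, ?_⟩
      · rw [DeformationDatum.IsSupersingular, sl]
        exact (div_pos (by linarith) hp1).ne
      · rw [sl]
        exact fun h => by
          have := Int.le_of_dvd one_pos (by simpa using h)
          omega
    · refine main (-7) (by norm_num) (by norm_num) (by norm_num) ?_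
      rw [sinf]
      field_simp
      push_cast
      ring
    · refine main 3 (by norm_num) (by norm_num) (by norm_num) ?_
      rw [s0]
      field_simp
      push_cast
      ring
  have hnot : ∀ x ∉ S, d.sigma x = 1 ∨ d.IsSupersingular x := by
    intro x hx
    simp only [hS, Set.mem_insert_iff, Set.mem_singleton_iff, not_or] at hx
    obtain ⟨h1, h2, h3, h4⟩ := hx
    obtain ⟨a, rfl⟩ := (ProjectiveLine.eq_finitePlace_or_eq_inftyPlace x).resolve_right h3
    by_cases hab₁ : a = b₁
    · exact Or.inr (hab₁ ▸ sb₁)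
    by_cases hab₂ : a = b₂
    · exact Or.inr (hab₂ ▸ sb₂)
    exact Or.inl (sgen a (fun h => h4 (h ▸ rfl)) (fun h => h1 (h ▸ rfl)) (fun h => h2 (h ▸ rfl))
      hab₁ hab₂)
  have hsing : {x | d.IsSingular x} = S := by
    ext x
    refine ⟨fun hx => by_contra fun hxS => ?_, fun hx => (hmem x hx).2⟩
    obtain h | h := hnot x hxS
    · exact hx.2 (by rw [h, sub_self, Rat.num_zero]; exact dvd_zero _)
    · exact hx.1 h
  have hsig : d.signatureSet = S := by
    ext x
    refine ⟨fun hx => by_contra fun hxS => ?_, fun hx => ⟨(hmem x hx).1, (hmem x hx).2.1⟩⟩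
    exact (hnot x hxS).elim hx.1 hx.2
  have f1 : ⌊d.sigma (ProjectiveLine.finitePlace 1)⌋ = 0 := by rw [s1, Int.floor_zero]
  have fl : ⌊d.sigma (ProjectiveLine.finitePlace l)⌋ = 0 := by rw [sl, Int.floor_zero]
  have finf : ⌊d.sigma (ProjectiveLine.inftyPlace k)⌋ = 0 := by
    rw [sinf, Int.floor_eq_zero_iff]
    -- Nonnegativity of `p - 8` is another use of `p ≥ 11`; below `8` the floor would be negative.
    exact ⟨div_nonneg (by linarith) hp1.le, (div_lt_one hp1).mpr (by linarith)⟩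
  have f0 : ⌊d.sigma (ProjectiveLine.finitePlace 0)⌋ = 1 := by
    rw [s0, Int.floor_eq_iff, le_div_iff₀ hp1, div_lt_iff₀ hp1]
    push_cast
    constructor <;> linarith
  refine ⟨l, hl0, hl, d, ⟨?_, ?_⟩, hsing, hsig.trans hsing.symm, s1, sl, sinf, s0⟩
  · rw [Set.ncard_eq_three]
    refine ⟨ProjectiveLine.finitePlace 1, ProjectiveLine.finitePlace l,
      ProjectiveLine.inftyPlace k, fun h => hl (ProjectiveLine.finitePlace_injective h).symm,
      ProjectiveLine.finitePlace_ne_inftyPlace 1, ProjectiveLine.finitePlace_ne_inftyPlace l, ?_⟩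
    ext x
    rw [Set.mem_ofPred_eq, hsig]
    constructor
    · rintro ⟨rfl | rfl | rfl | rfl, h⟩
      · simp
      · simp
      · simp
      · rw [f0] at h
        exact absurd h one_ne_zero
    · rintro (rfl | rfl | rfl)
      · exact ⟨by simp [hS], f1⟩
      · exact ⟨by simp [hS], fl⟩
      · exact ⟨by simp [hS], finf⟩
  · intro x hx h
    rw [hsig] at hx
    obtain rfl | rfl | rfl | rfl := hx
    · exact absurd f1 h
    · exact absurd fl h
    · exact absurd finf h
    · exact f0
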